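/- Let $\mathcal A$ be a unital $C^*$-algebra; all representations of $\mathcal A$ are unital. Let $k\ge 1$, and let $E$ be a product system of $C^*$-correspondences over $\mathbb N^k$: a semigroup fibred over $\mathbb N^k$ whose fibres $E(\mathbf n)$ are $C^*$-correspondences over $\mathcal A$, with $E(\mathbf 0)=\mathcal A$, such that multiplication extends to isomorphisms of correspondences $E(\mathbf n)\otimes E(\mathbf m)\cong E(\mathbf n+\mathbf m)$ (interior tensor product). Write $E_i=E(\mathbf e_i)$. *Representations of a correspondence.* A representation $(T,\sigma)$ of a $C^*$-correspondence $F$ on a Hilbert space $\mathcal H$ is a unital representation $\sigma:\mathcal A\to B(\mathcal H)$ with a completely contractive linear map $T:F\to B(\mathcal H)$ such that $T(a\xi b)=\sigma(a)T(\xi)\sigma(b)$. Let $\tilde T:F\otimes_\sigma\mathcal H\to\mathcal H$ be the contraction $\tilde T(\xi\otimes h)=T(\xi)h$. The representation is *isometric* if $T(\xi)^*T(\eta)=\sigma(\langle\xi,\eta\rangle)$ for all $\xi,\eta$, and *fully coisometric* if $\tilde T\tilde T^*=I$. A representation $(S,\rho)$ of $F$ on $\mathcal H\supseteq\mathcal V$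 is a *dilation* of a representation $(T,\sigma)$ of $F$ on $\mathcal V$ if $\mathcal V$ reduces $\rho$ with $\rho(a)|_{\mathcal V}=\sigma(a)$, $\mathcal V^\perp$ is invariant under every $S(\xi)$, and $P_{\mathcal V}S(\xi)|_{\mathcal V}=T(\xi)$. It is a *minimal isometric dilation* if moreover $(S,\rho)$ is isometric and $\mathcal H$ is the closed linear span of the vectors $S(\xi_1)\cdots S(\xi_m)v$ with $m\ge 0$, $\xi_j\in F$, $v\in\mathcal V$. *Representations of the product system.* A representation $(T^{(1)},\dots,T^{(k)},\sigma)$ of $E$ on $\mathcal H$ consists of representations $(T^{(i)},\sigma)$ of $E_i$ on $\mathcal H$ such that, for all $i,j$, $$\tilde T^{(i)}(I_{E_i}\otimes\tilde T^{(j)})=\tilde T^{(j)}(I_{E_j}\otimes\tilde T^{(i)})(t_{i,j}\otimes I_{\mathcal H}),$$ where $t_{i,j}:E_i\otimes E_j\to E_j\otimes E_i$ comes from identifying both sides with $E(\mathbf e_i+\mathbf e_j)$. It is isometric (fully coisometric) if every $(T^{(i)},\sigma)$ is. For $\mathbf n=(n_1,\dots,n_k)\in\mathbb N^k$, identify $E(\mathbf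 n)=E_1^{\otimes n_1}\otimes\cdots\otimes E_k^{\otimes n_k}$; the maps $\tilde T_{\mathbf n}:E(\mathbf n)\otimes_\sigma\mathcal H\to\mathcal H$ and $T_{\mathbf n}:E(\mathbf n)\to B(\mathcal H)$ are the bounded ones with $$T_{\mathbf n}(\xi_1\cdots\xi_r)h=\tilde T_{\mathbf n}(\xi_1\cdots\xi_r\otimes h)=T^{(i_1)}(\xi_1)\cdots T^{(i_r)}(\xi_r)h,\qquad \xi_j\in E_{i_j},$$ where $(i_1,\dots,i_r)=(1,\dots,1,\dots,k,\dots,k)$ with each $i$ occurring $n_i$ times. A representation $(S^{(1)},\dots,S^{(k)},\rho)$ of $E$ on $\mathcal H\supseteq\mathcal V$ is a *minimal isometric dilation* of a representation $(A^{(1)},\dots,A^{(k)},\sigma)$ of $E$ on $\mathcal V$ if each $(S^{(i)},\rho)$ is an isometric dilation of $(A^{(i)},\sigma)$ and $\mathcal H$ is the closed linear span of $\bigcup_{\mathbf n\in\mathbb N^k}\tilde S_{\mathbf n}(E(\mathbf n)\otimes\mathcal V)$. **Theorem.** Let $(A^{(1)},\dots,A^{(k)},\sigma)$ be a fully coisometric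 representation of $E$ on a Hilbert space $\mathcal V$ with minimal isometric dilation $(S^{(1)},\dots,S^{(k)},\rho)$ on a Hilbert space $\mathcal H$. If $\mathbf n=(n_1,\dots,n_k)\in\mathbb N^k$ satisfies $n_i\ne 0$ for $1\le i\le k$, then the representation $(S_{\mathbf n},\rho)$ of the $C^*$-correspondence $E(\mathbf n)$ is a minimal isometric dilation of the representation $(A_{\mathbf n},\sigma)$ of $E(\mathbf n)$. It is unique up to unitary equivalence fixing $\mathcal V$: if $(S',\rho')$ on $\mathcal H'\supseteq\mathcal V$ is any minimal isometric dilation of $(A_{\mathbf n},\sigma)$, there is a unitary $U:\mathcal H\to\mathcal H'$ with $U|_{\mathcal V}=\mathrm{id}_{\mathcal V}$, $U\rho(a)=\rho'(a)U$ for $a\in\mathcal A$ and $US_{\mathbf n}(\xi)=S'(\xi)U$ for $\xi\in E(\mathbf n)$. -/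

import Mathlib

open scoped TensorProduct InnerProductSpace
open MulOpposite

set_option linter.unusedSectionVars false

/-- A `C*`-correspondence `E` over the unital `C*`-algebra `A`.

`E` is a right Hilbert `A`-module: the right action is the action of `Aᵐᵒᵖ` (so `op a • x` is
`x a`), and Mathlib's `CStarModule Aᵐᵒᵖ E` provides the inner product (linear in the second
variable, with values in `Aᵐᵒᵖ`, which has the same underlying star-normed ordered space as `A`),
with `⟪x, y a⟫ = ⟪x, y⟫ a`, `⟪x, y⟫* = ⟪y, x⟫`, definiteness, and `‖x‖² = ‖⟪x, x⟫‖`.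
The left action `Module A E` is a unital homomorphism into the adjointable operators which
respects scalars and adjoints. -/
class CStarCorrespondence (A E : Type*) [CStarAlgebra A] [PartialOrder A] [StarOrderedRing A]
    [NormedAddCommGroup E] [NormedSpace ℂ E] [Module A E] [Module Aᵐᵒᵖ E]
    extends CStarModule Aᵐᵒᵖ E where
  complete : CompleteSpace E
  complex_smul_smul (c : ℂ) (a : A) (x : E) : (c • a) • x = c • (a • x)
  inner_smul_left_eq (a : A) (x y : E) : inner (a • x) y = inner x (star a • y)

namespace CStarCorrespondence

section Aux
variable {R : Type*} [CStarAlgebra R] [PartialOrder R] [StarOrderedRing R]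

lemma aux_negPart (G : R) (hG : IsSelfAdjoint G) :
    ∃ c : R, star c = c ∧ 0 ≤ c * c * c ∧ c * G * c = -(c * c * c) ∧ (c * c * c = 0 → 0 ≤ G) := by
  have hcsa : star G⁻ = G⁻ := (CFC.negPart_nonneg G).isSelfAdjoint
  refine ⟨G⁻, hcsa, ?_, ?_, ?_⟩
  · have := star_left_conjugate_nonneg (CFC.negPart_nonneg G) G⁻
    rwa [hcsa] at this
  · have h : G⁻ * (G⁺ - G⁻) = - (G⁻ * G⁻) := by rw [mul_sub]; simp
    have h' : G⁻ * G * G⁻ = G⁻ * (G⁺ - G⁻) * G⁻ := by rw [CFC.posPart_sub_negPart G hG]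
    rw [h', h, neg_mul]
  · intro h5
    have h6 : G⁻ = 0 := by
      have h7 : G⁻ * G⁻ = 0 := by
        rw [← CStarRing.star_mul_self_eq_zero_iff, star_mul, hcsa, ← mul_assoc, h5, zero_mul]
      rw [← CStarRing.star_mul_self_eq_zero_iff, hcsa, h7]
    rw [← CFC.posPart_sub_negPart G hG, h6, sub_zero]
    exact CFC.posPart_nonneg G

lemma aux_sqrt (G : R) (hG : 0 ≤ G) {ε : ℝ} (hε : 0 < ε) :
    ∃ c d : R, star d * d = G + (ε : ℂ) • 1 ∧ c * d = 1 ∧ ‖star c * G * c‖ ≤ 1 := by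
  have hp : IsStrictlyPositive (G + (ε : ℂ) • 1) := by
    have : IsStrictlyPositive ((ε : ℂ) • (1 : R)) := by
      have := (isStrictlyPositive_one (A := R)).smul hε
      simpa [Complex.coe_smul] using this
    exact IsStrictlyPositive.nonneg_add hG this
  have hd := hp.sqrt
  set d := CFC.sqrt (G + (ε : ℂ) • (1 : R)) with hd0
  have hdd : d * d = G + (ε : ℂ) • 1 := CFC.sqrt_mul_sqrt_self _ hp.nonneg
  have hds : star d = d := hd.isSelfAdjoint
  obtain ⟨u, hu⟩ := hd.isUnit
  refine ⟨↑u⁻¹, d, by rw [hds, hdd], by rw [← hu]; simp, ?_⟩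
  have h1 : star (↑u⁻¹ : R) * (G + (ε : ℂ) • 1) * ↑u⁻¹ = 1 := by
    rw [← hdd]
    nth_rewrite 1 [← hds]
    rw [← hu, ← mul_assoc, ← star_mul]
    simp
  have h2 : star (↑u⁻¹ : R) * G * ↑u⁻¹ ≤ 1 := by
    rw [← h1]
    refine star_left_conjugate_le_conjugate ?_ _
    refine le_add_of_nonneg_right ?_
    simpa [Complex.coe_smul] using smul_nonneg hε.le (zero_le_one (α := R))
  rwa [CStarAlgebra.norm_le_one_iff_of_nonneg _ (star_left_conjugate_nonneg hG _)]
lemma aux_star_mul_self (G : R) (hG : 0 ≤ G) : ∃ D : R, G = star D * D :=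
  CStarAlgebra.nonneg_iff_eq_star_mul_self.mp hG
end Aux

section Basic
variable (A : Type*) {E : Type*} [CStarAlgebra A] [PartialOrder A] [StarOrderedRing A]
    [NormedAddCommGroup E] [NormedSpace ℂ E] [Module A E] [Module Aᵐᵒᵖ E]
    [CStarCorrespondence A E]

/-- The inner product of `E` as an element of `A`; it satisfies `⟪x, y a⟫ = ⟪x, y⟫ a`. -/
def ip (x y : E) : A := unop (inner Aᵐᵒᵖ x y)

lemma ip_add_right (x y z : E) : ip A x (y + z) = ip A x y + ip A x z := by
  simp [ip, CStarModule.inner_add_right]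
lemma ip_add_left (x y z : E) : ip A (x + y) z = ip A x z + ip A y z := by
  simp [ip, CStarModule.inner_add_left]
lemma ip_smul_right (c : ℂ) (x y : E) : ip A x (c • y) = c • ip A x y := by
  simp [ip]
lemma star_ip (x y : E) : star (ip A x y) = ip A y x := by
  simp [ip, ← unop_star]
lemma ip_smul_left (c : ℂ) (x y : E) : ip A (c • x) y = star c • ip A x y := by
  rw [← star_ip, ip_smul_right, star_smul, star_ip]
lemma ip_op_smul_right (a : A) (x y : E) : ip A x (op a • y) = ip A x y * a := by
  simp [ip]
lemma ip_op_smul_left (a : A) (x y : E) : ip A (op a • x) y = star a * ip A x y := by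
  rw [← star_ip, ip_op_smul_right, star_mul, star_ip]
lemma ip_lsmul_left (a : A) (x y : E) : ip A (a • x) y = ip A x (star a • y) := by
  simp [ip, inner_smul_left_eq]
lemma ip_self_nonneg (x : E) : 0 ≤ ip A x x := by
  have : (0 : Aᵐᵒᵖ) ≤ inner Aᵐᵒᵖ x x := CStarModule.inner_self_nonneg
  exact this
lemma ip_self_eq_zero {x : E} : ip A x x = 0 ↔ x = 0 := by
  simp [ip, CStarModule.inner_self]
lemma norm_sq_eq (x : E) : ‖x‖ ^ 2 = ‖ip A x x‖ :=
  CStarModule.norm_sq_eq Aᵐᵒᵖ (x := x)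
lemma ip_sum_right {ι : Type*} (s : Finset ι) (x : E) (y : ι → E) :
    ip A x (∑ i ∈ s, y i) = ∑ i ∈ s, ip A x (y i) :=
  map_sum (AddMonoidHom.mk' (ip A x) (ip_add_right A x)) _ _
lemma ip_sum_left {ι : Type*} (s : Finset ι) (x : ι → E) (y : E) :
    ip A (∑ i ∈ s, x i) y = ∑ i ∈ s, ip A (x i) y :=
  map_sum (AddMonoidHom.mk' (fun x => ip A x y) (ip_add_left A · · y)) _ _
/-- The Gram matrix `(⟪x i, x j⟫)` with entries in `A`. -/
def gram {m : Type*} (x : m → E) : CStarMatrix m m A :=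
  CStarMatrix.ofMatrix fun i j => ip A (x i) (x j)

lemma gram_apply {m : Type*} (x : m → E) (i j : m) : gram A x i j = ip A (x i) (x j) := rfl

variable {m : Type*} [Fintype m] [DecidableEq m]

lemma gram_op_smul (x : m → E) (c : CStarMatrix m m A) :
    gram A (fun j => ∑ i, op (c i j) • x i) = star c * gram A x * c := by
  ext i j
  simp only [gram_apply, CStarMatrix.mul_apply, ip_sum_left, ip_sum_right, ip_op_smul_left,
    ip_op_smul_right, CStarMatrix.star_apply, Finset.sum_mul, mul_assoc]

lemma diag_nonneg {M : CStarMatrix m m A} (h : 0 ≤ M) (i : m) : 0 ≤ M i i := by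
  obtain ⟨D, rfl⟩ := aux_star_mul_self M h
  simp only [CStarMatrix.mul_apply, CStarMatrix.star_apply]
  exact Finset.sum_nonneg fun k _ => star_mul_self_nonneg _

lemma gram_isSelfAdjoint (x : m → E) : IsSelfAdjoint (gram A x) := by
  ext i j
  simp [gram_apply, CStarMatrix.star_apply, star_ip]

lemma gram_nonneg (x : m → E) : 0 ≤ gram A x := by
  obtain ⟨c, hcsa, h3, h1, h6⟩ := aux_negPart _ (gram_isSelfAdjoint A x)
  have h2 := gram_op_smul A x c
  rw [hcsa, h1] at h2
  have h4 : ∀ j, (∑ i, op (c i j) • x i) = 0 := by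
    intro j
    rw [← ip_self_eq_zero A]
    refine le_antisymm ?_ (ip_self_nonneg A _)
    have := congrFun (congrFun h2 j) j
    rw [gram_apply] at this
    rw [this]
    have := diag_nonneg A h3 j
    simpa using this
  refine h6 ?_
  rw [← neg_eq_zero, ← h2]
  ext i j
  simp [gram_apply, h4, ip_self_eq_zero]

lemma exists_gram_eq (x : m → E) : ∃ D : CStarMatrix m m A, gram A x = star D * D :=
  aux_star_mul_self _ (gram_nonneg A x)
end Basic
section Tensor
variable {A : Type*} [CStarAlgebra A] [PartialOrder A] [StarOrderedRing A]
  {H : Type*} [NormedAddCommGroup H] [InnerProductSpace ℂ H] [CompleteSpace H]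
  (σ : A →⋆ₐ[ℂ] (H →L[ℂ] H))
  (E : Type*) [NormedAddCommGroup E] [NormedSpace ℂ E] [Module A E] [Module Aᵐᵒᵖ E]
  [CStarCorrespondence A E]

/-- The algebraic tensor product of `E` and `H`, to be equipped with the semi-inner product
determined by `σ`. -/
def AlgTensor (_σ : A →⋆ₐ[ℂ] (H →L[ℂ] H)) (E : Type*) [NormedAddCommGroup E]
    [NormedSpace ℂ E] : Type _ := E ⊗[ℂ] H

noncomputable instance : AddCommGroup (AlgTensor σ E) :=
  inferInstanceAs (AddCommGroup (E ⊗[ℂ] H))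
noncomputable instance : Module ℂ (AlgTensor σ E) :=
  inferInstanceAs (Module ℂ (E ⊗[ℂ] H))

/-- The form `⟪ξ₁ ⊗ h₁, ξ₂ ⊗ h₂⟫ = ⟪h₁, σ ⟪ξ₁, ξ₂⟫ h₂⟫` on the algebraic tensor product. -/
noncomputable def tensorForm : (E ⊗[ℂ] H) →ₗ⋆[ℂ] (E ⊗[ℂ] H) →ₗ[ℂ] ℂ :=
  TensorProduct.lift <| LinearMap.mk₂'ₛₗ (starRingEnd ℂ) (starRingEnd ℂ)
    (fun ξ h => TensorProduct.lift <| LinearMap.mk₂ ℂ (fun η k => ⟪h, σ (ip A ξ η) k⟫_ℂ)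
      (fun _ _ _ => by simp [ip_add_right])
      (fun _ _ _ => by simp [ip_smul_right])
      (fun _ _ _ => by simp)
      (fun _ _ _ => by simp))
    (fun _ _ _ => TensorProduct.ext' fun _ _ => by simp [ip_add_left])
    (fun _ _ _ => TensorProduct.ext' fun _ _ => by simp [ip_smul_left])
    (fun _ _ _ => TensorProduct.ext' fun _ _ => by simp)
    (fun _ _ _ => TensorProduct.ext' fun _ _ => by simp [mul_comm])

lemma tensorForm_tmul (ξ η : E) (h k : H) :
    tensorForm σ E (ξ ⊗ₜ h) (η ⊗ₜ k) = ⟪h, σ (ip A ξ η) k⟫_ℂ := rfl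

lemma sum_inner_gram {m : Type*} [Fintype m] [DecidableEq m] (G D : CStarMatrix m m A)
    (hGD : G = star D * D) (h : m → H) :
    ∑ i, ∑ j, ⟪h i, σ (G i j) (h j)⟫_ℂ = ∑ k, ((‖∑ j, σ (D k j) (h j)‖ : ℂ)) ^ 2 := by
  have : ∀ k, ((‖∑ j, σ (D k j) (h j)‖ : ℂ)) ^ 2
      = ∑ i, ∑ j, ⟪h i, σ (star (D k i) * D k j) (h j)⟫_ℂ := by
    intro k
    have := inner_self_eq_norm_sq_to_K (𝕜 := ℂ) (∑ j, σ (D k j) (h j))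
    rw [RCLike.ofReal_eq_complex_ofReal] at this
    rw [← this]
    simp only [sum_inner, inner_sum]
    rw [Finset.sum_comm]
    refine Finset.sum_congr rfl fun i _ => Finset.sum_congr rfl fun j _ => ?_
    rw [map_mul, map_star, ContinuousLinearMap.star_eq_adjoint, mul_apply_eq_comp,
      ContinuousLinearMap.adjoint_inner_right]
  simp only [this]
  calc ∑ i, ∑ j, ⟪h i, σ (G i j) (h j)⟫_ℂ
      = ∑ i, ∑ j, ∑ k, ⟪h i, σ (star (D k i) * D k j) (h j)⟫_ℂ := by
        refine Finset.sum_congr rfl fun i _ => Finset.sum_congr rfl fun j _ => ?_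
        rw [hGD, CStarMatrix.mul_apply]
        simp only [CStarMatrix.star_apply, map_sum, sum_apply, inner_sum]
    _ = ∑ i, ∑ k, ∑ j, ⟪h i, σ (star (D k i) * D k j) (h j)⟫_ℂ :=
        Finset.sum_congr rfl fun i _ => Finset.sum_comm
    _ = _ := Finset.sum_comm

lemma tensorForm_symm (x y : E ⊗[ℂ] H) :
    (starRingEnd ℂ) (tensorForm σ E y x) = tensorForm σ E x y := by
  induction x using TensorProduct.induction_on with
  | zero => simp
  | add x y hx hy => simp [hx, hy]
  | tmul ξ h =>
    induction y using TensorProduct.induction_on with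
    | zero => simp
    | add x y hx hy => simp [hx, hy]
    | tmul η k =>
      rw [tensorForm_tmul, tensorForm_tmul, inner_conj_symm,
        ← ContinuousLinearMap.adjoint_inner_right, ← ContinuousLinearMap.star_eq_adjoint,
        ← map_star, star_ip]

lemma tensorForm_nonneg (x : E ⊗[ℂ] H) : 0 ≤ (tensorForm σ E x x).re := by
  obtain ⟨N, ξ, h, rfl⟩ := TensorProduct.exists_sum_tmul_eq x
  obtain ⟨D, hD⟩ := exists_gram_eq A ξ
  have h1 := sum_inner_gram σ _ D hD h
  have h2 : tensorForm σ E (∑ j, ξ j ⊗ₜ h j) (∑ j, ξ j ⊗ₜ h j)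
      = ∑ i, ∑ j, ⟪h i, σ (gram A ξ i j) (h j)⟫_ℂ := by
    simp only [map_sum, LinearMap.sum_apply, tensorForm_tmul, gram_apply]
    rw [Finset.sum_comm]
  rw [h2, h1, Complex.re_sum]
  exact Finset.sum_nonneg fun k _ => by
    rw [← Complex.ofReal_pow, Complex.ofReal_re]; positivity

noncomputable instance instCore : PreInnerProductSpace.Core ℂ (AlgTensor σ E) where
  inner x y := tensorForm σ E x y
  conj_inner_symm x y := tensorForm_symm σ E x y
  re_inner_nonneg x := tensorForm_nonneg σ E x
  add_left _ _ _ := LinearMap.map_add₂ _ _ _ _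
  smul_left _ _ _ := LinearMap.map_smulₛₗ₂ _ _ _ _

noncomputable instance : SeminormedAddCommGroup (AlgTensor σ E) :=
  InnerProductSpace.Core.toSeminormedAddCommGroup (𝕜 := ℂ)
noncomputable instance : InnerProductSpace ℂ (AlgTensor σ E) :=
  InnerProductSpace.ofCore (instCore σ E)

/-- The Hilbert space `E ⊗_σ H`: the Hausdorff completion of the algebraic tensor product. -/
def IndTensor : Type _ := UniformSpace.Completion (AlgTensor σ E)

noncomputable instance : NormedAddCommGroup (IndTensor σ E) :=
  inferInstanceAs (NormedAddCommGroup (UniformSpace.Completion (AlgTensor σ E)))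
noncomputable instance : InnerProductSpace ℂ (IndTensor σ E) :=
  inferInstanceAs (InnerProductSpace ℂ (UniformSpace.Completion (AlgTensor σ E)))
instance : CompleteSpace (IndTensor σ E) :=
  inferInstanceAs (CompleteSpace (UniformSpace.Completion (AlgTensor σ E)))

variable {E}

/-- The canonical map of the algebraic tensor product into `E ⊗_σ H`. -/
noncomputable def tmulₗ : (E ⊗[ℂ] H) →ₗ[ℂ] IndTensor σ E :=
  (UniformSpace.Completion.toComplL (𝕜 := ℂ) (E := AlgTensor σ E)).toLinearMap

/-- The elementary tensor `ξ ⊗ h` in `E ⊗_σ H`. -/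
noncomputable def tmul (ξ : E) (h : H) : IndTensor σ E := tmulₗ σ (ξ ⊗ₜ h)

lemma inner_tmul (ξ η : E) (h k : H) :
    ⟪tmul σ ξ h, tmul σ η k⟫_ℂ = ⟪h, σ (ip A ξ η) k⟫_ℂ :=
  UniformSpace.Completion.inner_coe (E := AlgTensor σ E) _ _

lemma denseRange_tmulₗ : DenseRange (tmulₗ σ (E := E)) :=
  UniformSpace.Completion.denseRange_coe (α := AlgTensor σ E)

lemma tmul_add (ξ : E) (h k : H) : tmul σ ξ (h + k) = tmul σ ξ h + tmul σ ξ k := by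
  simp [tmul, TensorProduct.tmul_add]
lemma add_tmul (ξ η : E) (h : H) : tmul σ (ξ + η) h = tmul σ ξ h + tmul σ η h := by
  simp [tmul, TensorProduct.add_tmul]
lemma tmul_smul (c : ℂ) (ξ : E) (h : H) : tmul σ ξ (c • h) = c • tmul σ ξ h := by
  simp [tmul]
lemma smul_tmul (c : ℂ) (ξ : E) (h : H) : tmul σ (c • ξ) h = c • tmul σ ξ h := by
  simp [tmul, ← TensorProduct.smul_tmul']

lemma norm_sum_tmul_sq {N : ℕ} (ξ : Fin N → E) (h : Fin N → H) :
    ((‖∑ i, tmul σ (ξ i) (h i)‖ : ℂ)) ^ 2 = ∑ i, ∑ j, ⟪h i, σ (ip A (ξ i) (ξ j)) (h j)⟫_ℂ := by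
  have := inner_self_eq_norm_sq_to_K (𝕜 := ℂ) (∑ i, tmul σ (ξ i) (h i))
  rw [RCLike.ofReal_eq_complex_ofReal] at this
  rw [← this]
  simp only [sum_inner, inner_sum, inner_tmul]
  rw [Finset.sum_comm]

lemma op_smul_tmul (a : A) (ξ : E) (h : H) : tmul σ (op a • ξ) h = tmul σ ξ (σ a h) := by
  have h1 : ∀ ξ' h', ⟪tmul σ ξ' h', tmul σ (op a • ξ) h - tmul σ ξ (σ a h)⟫_ℂ = 0 := by
    intro ξ' h'
    rw [inner_sub_right, inner_tmul, inner_tmul, ip_op_smul_right, map_mul, mul_apply_eq_comp, sub_self]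
  rw [← sub_eq_zero, ← inner_self_eq_zero (𝕜 := ℂ), inner_sub_left, h1, h1, sub_self]

lemma indTensor_ext {K : Type*} [NormedAddCommGroup K] [NormedSpace ℂ K] {T T' : IndTensor σ E →L[ℂ] K}
    (h : ∀ ξ k, T (tmul σ ξ k) = T' (tmul σ ξ k)) : T = T' := by
  apply DFunLike.coe_injective
  refine (denseRange_tmulₗ σ).equalizer T.continuous T'.continuous ?_
  have : T.toLinearMap ∘ₗ tmulₗ σ = T'.toLinearMap ∘ₗ tmulₗ σ :=
    TensorProduct.ext' fun ξ k => h ξ k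
  exact congrArg DFunLike.coe this

lemma norm_tmul_le (ξ : E) (h : H) : ‖tmul σ ξ h‖ ≤ ‖ξ‖ * ‖h‖ := by
  refine abs_le_of_sq_le_sq' ?_ (by positivity) |>.2
  have h1 := inner_self_eq_norm_sq (𝕜 := ℂ) (tmul σ ξ h)
  rw [← h1, inner_tmul]
  calc _ ≤ ‖⟪h, σ (ip A ξ ξ) h⟫_ℂ‖ := RCLike.re_le_norm _
    _ ≤ ‖h‖ * (‖ip A ξ ξ‖ * ‖h‖) := by
        refine (norm_inner_le_norm _ _).trans ?_
        gcongr
        refine (ContinuousLinearMap.le_opNorm _ _).trans ?_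
        gcongr
        exact NonUnitalStarAlgHom.norm_apply_le σ _
    _ = (‖ξ‖ * ‖h‖) ^ 2 := by rw [← norm_sq_eq A]; ring

/-- The operator `h ↦ ξ ⊗ h`. -/
noncomputable def creation (ξ : E) : H →L[ℂ] IndTensor σ E :=
  LinearMap.mkContinuous ⟨⟨tmul σ ξ, tmul_add σ ξ⟩, fun c h => tmul_smul σ c ξ h⟩ ‖ξ‖
    (norm_tmul_le σ ξ)

@[simp] lemma creation_apply (ξ : E) (h : H) : creation σ ξ h = tmul σ ξ h := rfl

lemma continuous_tmul_left (h : H) : Continuous fun ξ : E => tmul σ ξ h :=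
  AddMonoidHomClass.continuous_of_bound
    (AddMonoidHom.mk' (fun ξ : E => tmul σ ξ h) fun ξ η => add_tmul σ ξ η h) ‖h‖
    fun ξ => (norm_tmul_le σ ξ h).trans_eq (mul_comm _ _)

lemma exists_extension {X K L : Type*} [AddCommGroup X] [Module ℂ X] [NormedAddCommGroup K] [NormedSpace ℂ K]
    [NormedAddCommGroup L] [NormedSpace ℂ L] [CompleteSpace L] (g : X →ₗ[ℂ] K) (f : X →ₗ[ℂ] L)
    (hg : DenseRange g) (hfg : ∀ x, ‖f x‖ ≤ ‖g x‖) :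
    ∃ T : K →L[ℂ] L, ‖T‖ ≤ 1 ∧ ∀ x, T (g x) = f x := by
  have h' : ∀ x, ‖f x‖ ≤ 1 * ‖g x‖ := by simpa using hfg
  refine ⟨f.extendOfNorm g, ContinuousLinearMap.opNorm_le_bound _ zero_le_one
    (LinearMap.norm_extendOfNorm_apply_le hg 1 h'), LinearMap.extendOfNorm_eq hg ⟨1, h'⟩⟩

end Tensor

lemma linearCombination_eq_sum_fin {X K : Type*} [AddCommGroup K] [Module ℂ K] (v : X → K)
    (f : X →₀ ℂ) : Finsupp.linearCombination ℂ v f = ∑ i : Fin f.support.card,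
      f (f.support.equivFin.symm i) • v (f.support.equivFin.symm i) := by
  rw [Finsupp.linearCombination_apply, Finsupp.sum, ← Finset.sum_coe_sort,
    ← f.support.equivFin.symm.sum_comp]

section Rep
variable {A : Type*} [CStarAlgebra A] [PartialOrder A] [StarOrderedRing A]
  {H : Type*} [NormedAddCommGroup H] [InnerProductSpace ℂ H] [CompleteSpace H]
  (σ : A →⋆ₐ[ℂ] (H →L[ℂ] H))
  {E : Type*} [NormedAddCommGroup E] [NormedSpace ℂ E] [Module A E] [Module Aᵐᵒᵖ E]
  [CStarCorrespondence A E]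

/-- `(T, σ)` is a completely contractive covariant representation of `E` on `H` (with `σ` a unital
representation of `A`).

Complete contractivity: for every matrix `ξ` over `E`, the operator matrix `(T (ξ i j))` on `H^N`
has norm at most the norm of `ξ`, where the square of the norm of `ξ` is the norm of its
matrix-valued inner square `∑ k, ⟪ξ k i, ξ k j⟫` in the `C*`-algebra of matrices over `A`. -/
structure IsCovariantRep (σ : A →⋆ₐ[ℂ] (H →L[ℂ] H)) (T : E →ₗ[ℂ] (H →L[ℂ] H)) : Prop where
  covariant (a b : A) (ξ : E) : T (a • op b • ξ) = σ a * T ξ * σ b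
  completelyContractive (N : ℕ) (ξ : Matrix (Fin N) (Fin N) E) (h : Fin N → H) :
    ∑ i, ‖∑ j, T (ξ i j) (h j)‖ ^ 2 ≤
      ‖(CStarMatrix.ofMatrix fun i j => ∑ k, ip A (ξ k i) (ξ k j) :
        CStarMatrix (Fin N) (Fin N) A)‖ * ∑ j, ‖h j‖ ^ 2

namespace IsCovariantRep
variable {σ} {T : E →ₗ[ℂ] (H →L[ℂ] H)}

lemma map_smul_left (hT : IsCovariantRep σ T) (a : A) (ξ : E) : T (a • ξ) = σ a * T ξ := by
  simpa using hT.covariant a 1 ξ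

lemma map_op_smul (hT : IsCovariantRep σ T) (a : A) (ξ : E) : T (op a • ξ) = T ξ * σ a := by
  simpa using hT.covariant 1 a ξ

lemma row_bound (hT : IsCovariantRep σ T) {N : ℕ} (ξ : Fin N → E) (h : Fin N → H) :
    ‖∑ i, T (ξ i) (h i)‖ ^ 2 ≤ ‖∑ i, tmul σ (ξ i) (h i)‖ ^ 2 := by
  have key : ∀ ε : ℝ, 0 < ε → ‖∑ i, T (ξ i) (h i)‖ ^ 2
      ≤ ‖∑ i, tmul σ (ξ i) (h i)‖ ^ 2 + ε * ∑ i, ‖h i‖ ^ 2 := by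
    intro ε hε
    obtain ⟨c, d, hd, hcd, hn⟩ := aux_sqrt _ (gram_nonneg A ξ) hε
    obtain rfl | ⟨M, rfl⟩ : N = 0 ∨ ∃ M, N = M + 1 := by
      cases N with
      | zero => exact Or.inl rfl
      | succ M => exact Or.inr ⟨M, rfl⟩
    · simp
    set ξ' : Fin (M + 1) → E := fun j => ∑ i, op (c i j) • ξ i with hξ'
    set h' : Fin (M + 1) → H := fun j => ∑ i, σ (d j i) (h i) with hh'
    have e1 : ∀ i, ξ i = ∑ j, op (d j i) • ξ' j := by
      intro i
      have : ∀ l, ∑ j, c l j * d j i = if l = i then 1 else 0 := by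
        intro l
        rw [← CStarMatrix.mul_apply, hcd, CStarMatrix.one_apply]
      simp only [hξ', Finset.smul_sum, smul_smul, ← op_mul]
      rw [Finset.sum_comm]
      simp only [← Finset.sum_smul, ← Finset.op_sum, this]
      simp [apply_ite (op : A → Aᵐᵒᵖ), ite_smul]
    have e2 : ∑ i, T (ξ i) (h i) = ∑ j, T (ξ' j) (h' j) := by
      calc ∑ i, T (ξ i) (h i) = ∑ i, ∑ j, T (ξ' j) (σ (d j i) (h i)) := by
            refine Finset.sum_congr rfl fun i _ => ?_
            conv_lhs => rw [e1 i]
            simp [map_sum, sum_apply, hT.map_op_smul, mul_apply_eq_comp]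
        _ = _ := by rw [Finset.sum_comm]; simp [hh']
    have e3 : ‖∑ j, T (ξ' j) (h' j)‖ ^ 2 ≤ ∑ j, ‖h' j‖ ^ 2 := by
      have := hT.completelyContractive (M + 1)
        (Matrix.of fun i j => if i = 0 then ξ' j else 0) h'
      have e : (CStarMatrix.ofMatrix fun i j => ∑ k : Fin (M + 1),
          ip A ((Matrix.of fun i j => if i = 0 then ξ' j else 0) k i)
            ((Matrix.of fun i j => if i = 0 then ξ' j else 0) k j) :
          CStarMatrix (Fin (M + 1)) (Fin (M + 1)) A) = gram A ξ' := by
        ext i j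
        change ∑ k : Fin (M + 1), ip A (if k = 0 then ξ' i else 0) (if k = 0 then ξ' j else 0)
          = ip A (ξ' i) (ξ' j)
        rw [Finset.sum_eq_single 0]
        · simp
        · intro k _ hk
          simp [hk, ip]
        · simp
      rw [e, gram_op_smul] at this
      have h2 : ‖∑ j, T (ξ' j) (h' j)‖ ^ 2 ≤ ∑ i : Fin (M + 1),
          ‖∑ j, T ((Matrix.of fun i j => if i = 0 then ξ' j else 0 :
            Matrix (Fin (M + 1)) (Fin (M + 1)) E) i j) (h' j)‖ ^ 2 := by
        refine le_trans (le_of_eq ?_) (Finset.single_le_sum (f := fun i => ‖∑ j, T ((Matrix.of fun i j => if i = 0 then ξ' j else 0 :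
            Matrix (Fin (M + 1)) (Fin (M + 1)) E) i j) (h' j)‖ ^ 2) (fun i _ => by positivity) (Finset.mem_univ 0))
        simp
      refine h2.trans (this.trans ?_)
      exact mul_le_of_le_one_left (Finset.sum_nonneg fun _ _ => by positivity) hn
    have e4 : (∑ j, ‖h' j‖ ^ 2 : ℝ) = ‖∑ i, tmul σ (ξ i) (h i)‖ ^ 2 + ε * ∑ i, ‖h i‖ ^ 2 := by
      have h1 := sum_inner_gram σ _ d hd.symm h
      have h2 := norm_sum_tmul_sq σ ξ h
      apply Complex.ofReal_injective
      push_cast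
      rw [h2, ← h1, Finset.mul_sum, ← Finset.sum_add_distrib]
      refine Finset.sum_congr rfl fun i _ => ?_
      have : ∀ j, ⟪h i, σ ((gram A ξ + (ε : ℂ) • 1 : CStarMatrix _ _ A) i j) (h j)⟫_ℂ
          = ⟪h i, σ (ip A (ξ i) (ξ j)) (h j)⟫_ℂ + if i = j then (ε : ℂ) * (‖h i‖ : ℂ) ^ 2 else 0 := by
        intro j
        rw [CStarMatrix.add_apply, CStarMatrix.smul_apply, CStarMatrix.one_apply, gram_apply]
        split_ifs with hij
        · subst hij
          have := inner_self_eq_norm_sq_to_K (𝕜 := ℂ) (h i)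
          rw [RCLike.ofReal_eq_complex_ofReal] at this
          rw [map_add, map_smul, map_one, add_apply,
            smul_apply, one_apply_eq_self, inner_add_right,
            inner_smul_right, this]
        · simp
      simp only [this, Finset.sum_add_distrib, Finset.sum_ite_eq, Finset.mem_univ, if_true]
    rw [e2, ← e4]
    exact e3
  refine le_of_forall_pos_le_add fun δ hδ => ?_
  set s := ∑ i, ‖h i‖ ^ 2
  have hs : 0 ≤ s := Finset.sum_nonneg fun _ _ => by positivity
  refine (key (δ / (s + 1)) (by positivity)).trans ?_
  gcongr
  rw [div_mul_eq_mul_div, div_le_iff₀ (by positivity)]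
  nlinarith

lemma exists_tilde (hT : IsCovariantRep σ T) :
    ∃ S : IndTensor σ E →L[ℂ] H, ‖S‖ ≤ 1 ∧ ∀ ξ h, S (tmul σ ξ h) = T ξ h := by
  obtain ⟨S, hS, hS'⟩ := exists_extension (tmulₗ σ (E := E))
    (TensorProduct.lift (LinearMap.mk₂ ℂ (fun ξ h => T ξ h) (by simp) (by simp) (by simp) (by simp)))
    (denseRange_tmulₗ σ) (by
      intro x
      obtain ⟨N, ξ, h, rfl⟩ := TensorProduct.exists_sum_tmul_eq x
      have := hT.row_bound ξ h
      simp only [map_sum, TensorProduct.lift.tmul, LinearMap.mk₂_apply]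
      exact abs_le_of_sq_le_sq' this (norm_nonneg _) |>.2)
  exact ⟨S, hS, fun ξ h => by rw [tmul, hS']; simp⟩

/-- The operator `T̃ : E ⊗_σ H → H`, `T̃ (ξ ⊗ h) = T ξ h`. -/
noncomputable def tilde (hT : IsCovariantRep σ T) : IndTensor σ E →L[ℂ] H :=
  hT.exists_tilde.choose

lemma tilde_tmul (hT : IsCovariantRep σ T) (ξ : E) (h : H) : hT.tilde (tmul σ ξ h) = T ξ h :=
  hT.exists_tilde.choose_spec.2 ξ h

/-- The representation is fully coisometric: `T̃ T̃* = 1`. -/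
def IsFullyCoisometric (hT : IsCovariantRep σ T) : Prop :=
  hT.tilde ∘L ContinuousLinearMap.adjoint hT.tilde = ContinuousLinearMap.id ℂ H

end IsCovariantRep

/-- The representation `(T, σ)` is isometric: `T(ξ)* T(η) = σ ⟪ξ, η⟫`. -/
def IsIsometricRep (σ : A →⋆ₐ[ℂ] (H →L[ℂ] H)) (T : E →ₗ[ℂ] (H →L[ℂ] H)) : Prop :=
  ∀ ξ η : E, ContinuousLinearMap.adjoint (T ξ) ∘L T η = σ (ip A ξ η)

section Dilation
variable {V : Type*} [NormedAddCommGroup V] [InnerProductSpace ℂ V] [CompleteSpace V]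

/-- The representation `(S, ρ)` of `E` on `H` is a dilation of the representation `(T, σ)` on `V`,
where `V` is regarded as a closed subspace of `H` through the isometry `ι`. -/
structure IsDilation (ι : V →ₗᵢ[ℂ] H) (σ : A →⋆ₐ[ℂ] (V →L[ℂ] V)) (T : E →ₗ[ℂ] (V →L[ℂ] V))
    (ρ : A →⋆ₐ[ℂ] (H →L[ℂ] H)) (S : E →ₗ[ℂ] (H →L[ℂ] H)) : Prop where
  isCovariantRep_small : IsCovariantRep σ T
  isCovariantRep_big : IsCovariantRep ρ S
  restrict (a : A) (v : V) : ρ a (ι v) = ι (σ a v)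
  reduces (a : A) (x : H) (hx : x ∈ (LinearMap.range ι.toLinearMap)ᗮ) :
    ρ a x ∈ (LinearMap.range ι.toLinearMap)ᗮ
  invariant (ξ : E) (x : H) (hx : x ∈ (LinearMap.range ι.toLinearMap)ᗮ) :
    S ξ x ∈ (LinearMap.range ι.toLinearMap)ᗮ
  compress (ξ : E) :
    ContinuousLinearMap.adjoint ι.toContinuousLinearMap ∘L S ξ ∘L ι.toContinuousLinearMap = T ξ

/-- `(S, ρ)` is a minimal isometric dilation of `(T, σ)`. Minimality: the vectors
`S(ξ₁) ⋯ S(ξₙ) v` with `n ≥ 0`, `ξᵢ ∈ E` and `v ∈ V` span a dense subspace of `H`. -/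
structure IsMinimalIsometricDilation (ι : V →ₗᵢ[ℂ] H) (σ : A →⋆ₐ[ℂ] (V →L[ℂ] V))
    (T : E →ₗ[ℂ] (V →L[ℂ] V)) (ρ : A →⋆ₐ[ℂ] (H →L[ℂ] H)) (S : E →ₗ[ℂ] (H →L[ℂ] H)) : Prop
    extends IsDilation ι σ T ρ S where
  isometric : IsIsometricRep ρ S
  minimal : (Submodule.span ℂ
    {x : H | ∃ (l : List E) (v : V), x = (l.map S).prod (ι v)}).topologicalClosure = ⊤

end Dilation

variable {F G : Type*} [NormedAddCommGroup F] [NormedSpace ℂ F] [Module A F] [Module Aᵐᵒᵖ F]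
  [CStarCorrespondence A F] [NormedAddCommGroup G] [NormedSpace ℂ G] [Module A G] [Module Aᵐᵒᵖ G]
  [CStarCorrespondence A G]

lemma exists_comp {σ : A →⋆ₐ[ℂ] (H →L[ℂ] H)} {T : E →ₗ[ℂ] (H →L[ℂ] H)} (hT : IsCovariantRep σ T)
    (R : IndTensor σ F →L[ℂ] H) (hR : ‖R‖ ≤ 1) (μ : F → E → G)
    (hμ : ∀ x y x' y', ip A (μ x y) (μ x' y') = ip A y (ip A x x' • y'))
    (hd : Dense (Submodule.span ℂ (Set.range fun p : F × E => μ p.1 p.2) : Set G)) :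
    ∃ S : IndTensor σ G →L[ℂ] H, ‖S‖ ≤ 1 ∧
      ∀ x y h, S (tmul σ (μ x y) h) = R (tmul σ x (T y h)) := by
  have bound : ∀ (N : ℕ) (x : Fin N → F) (y : Fin N → E) (h : Fin N → H),
      ‖∑ i, R (tmul σ (x i) (T (y i) (h i)))‖ ^ 2 ≤ ‖∑ i, tmul σ (μ (x i) (y i)) (h i)‖ ^ 2 := by
    intro N x y h
    obtain ⟨D, hD⟩ := exists_gram_eq A x
    have h1 : ‖∑ i, R (tmul σ (x i) (T (y i) (h i)))‖ ^ 2
        ≤ ‖∑ i, tmul σ (x i) (T (y i) (h i))‖ ^ 2 := by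
      rw [← map_sum]
      gcongr
      exact (R.le_opNorm _).trans (mul_le_of_le_one_left (norm_nonneg _) hR)
    have h2 : ‖∑ i, tmul σ (x i) (T (y i) (h i))‖ ^ 2
        = ∑ k, ‖∑ j, T (D k j • y j) (h j)‖ ^ 2 := by
      apply Complex.ofReal_injective
      push_cast
      rw [norm_sum_tmul_sq]
      have := sum_inner_gram σ _ D hD fun i => T (y i) (h i)
      simp only [gram_apply] at this
      rw [this]
      simp [hT.map_smul_left, mul_apply_eq_comp]
    have h3 : ‖∑ i, tmul σ (μ (x i) (y i)) (h i)‖ ^ 2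
        = ∑ k, ‖∑ j, tmul σ (D k j • y j) (h j)‖ ^ 2 := by
      apply Complex.ofReal_injective
      push_cast
      simp only [norm_sum_tmul_sq]
      calc ∑ i, ∑ j, ⟪h i, σ (ip A (μ (x i) (y i)) (μ (x j) (y j))) (h j)⟫_ℂ
          = ∑ i, ∑ j, ∑ k, ⟪h i, σ (ip A (D k i • y i) (D k j • y j)) (h j)⟫_ℂ := by
            refine Finset.sum_congr rfl fun i _ => Finset.sum_congr rfl fun j _ => ?_
            rw [hμ, ← gram_apply, hD, CStarMatrix.mul_apply, Finset.sum_smul, ip_sum_right,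
              map_sum, sum_apply, inner_sum]
            refine Finset.sum_congr rfl fun k _ => ?_
            rw [ip_lsmul_left, smul_smul, CStarMatrix.star_apply]
        _ = ∑ i, ∑ k, ∑ j, ⟪h i, σ (ip A (D k i • y i) (D k j • y j)) (h j)⟫_ℂ :=
            Finset.sum_congr rfl fun i _ => Finset.sum_comm
        _ = _ := Finset.sum_comm
    refine h1.trans ?_
    rw [h2, h3]
    exact Finset.sum_le_sum fun k _ => hT.row_bound _ _
  obtain ⟨S, hS, hS'⟩ := exists_extension
    (Finsupp.linearCombination ℂ fun p : F × E × H => tmul σ (μ p.1 p.2.1) p.2.2)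
    (Finsupp.linearCombination ℂ fun p : F × E × H => R (tmul σ p.1 (T p.2.1 p.2.2)))
    (by
      set P := (LinearMap.range (Finsupp.linearCombination ℂ
        fun p : F × E × H => tmul σ (μ p.1 p.2.1) p.2.2)).topologicalClosure with hP
      have hPc : IsClosed (P : Set (IndTensor σ G)) := Submodule.isClosed_topologicalClosure _
      have h1 : ∀ (z : G) (h : H), tmul σ z h ∈ P := by
        intro z h
        have hcl : IsClosed {z : G | tmul σ z h ∈ P} := hPc.preimage (continuous_tmul_left σ h)
        have hsub : ((Submodule.span ℂ (Set.range fun p : F × E => μ p.1 p.2) : Submodule ℂ G) : Set G)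
            ⊆ {z : G | tmul σ z h ∈ P} := by
          intro z hz
          induction hz using Submodule.span_induction with
          | mem z hz =>
            obtain ⟨p, rfl⟩ := hz
            refine Submodule.le_topologicalClosure _ ⟨Finsupp.single (p.1, p.2, h) 1, ?_⟩
            simp
          | zero =>
            have : tmul σ (0 : G) h = 0 := by simp [tmul]
            simp [this]
          | add x y _ _ hx hy =>
            simpa [add_tmul] using P.add_mem hx hy
          | smul c x _ hx => simpa [smul_tmul] using P.smul_mem c hx
        exact (closure_minimal hsub hcl) (hd z)
      have h2 : Set.range (tmulₗ σ (E := G)) ⊆ P := by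
        rintro _ ⟨z, rfl⟩
        induction z using TensorProduct.induction_on with
        | zero => simp
        | tmul z h => exact h1 z h
        | add x y hx hy => simpa using P.add_mem hx hy
      intro z
      exact closure_minimal h2 hPc (denseRange_tmulₗ σ z))
    (by
      intro f
      rw [linearCombination_eq_sum_fin, linearCombination_eq_sum_fin]
      simp only [← map_smul, ← tmul_smul]
      exact abs_le_of_sq_le_sq' (bound _ _ _ _) (norm_nonneg _) |>.2)
  refine ⟨S, hS, fun x y h => ?_⟩
  have := hS' (Finsupp.single (x, y, h) 1)
  simpa using this

end Rep
section LeftAction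
variable {A : Type*} [CStarAlgebra A] [PartialOrder A] [StarOrderedRing A]
  {E : Type*} [NormedAddCommGroup E] [NormedSpace ℂ E] [Module A E] [Module Aᵐᵒᵖ E]
  [CStarCorrespondence A E]

lemma ip_sub_left (x y z : E) : ip A (x - y) z = ip A x z - ip A y z := by
  rw [eq_sub_iff_add_eq, ← ip_add_left, sub_add_cancel]

lemma ip_smul_self_le (a : A) (x : E) : ip A (a • x) (a • x) ≤ ((‖a‖ ^ 2 : ℝ) : ℂ) • ip A x x := by
  have h1 : 0 ≤ ((‖a‖ ^ 2 : ℝ) : ℂ) • (1 : A) - star a * a := by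
    have := CStarAlgebra.star_mul_le_algebraMap_norm_sq (a := a)
    rw [sub_nonneg]
    simpa [Algebra.algebraMap_eq_smul_one, ← Complex.ofReal_pow] using this
  obtain ⟨b, hb⟩ := aux_star_mul_self _ h1
  have h2 := ip_self_nonneg A (b • x)
  rw [ip_lsmul_left, smul_smul, ← hb, sub_smul, complex_smul_smul, one_smul] at h2
  have h3 : ip A x (((‖a‖ ^ 2 : ℝ) : ℂ) • x - (star a * a) • x)
      = ((‖a‖ ^ 2 : ℝ) : ℂ) • ip A x x - ip A (a • x) (a • x) := by
    rw [ip_lsmul_left, smul_smul, eq_sub_iff_add_eq, ← ip_add_right, sub_add_cancel, ip_smul_right]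
  rwa [h3, sub_nonneg] at h2

lemma norm_smul_le_mul (a : A) (x : E) : ‖a • x‖ ≤ ‖a‖ * ‖x‖ := by
  refine abs_le_of_sq_le_sq' ?_ (by positivity) |>.2
  rw [norm_sq_eq A, mul_pow, norm_sq_eq A x]
  refine (CStarAlgebra.norm_le_norm_of_nonneg_of_le (ip_self_nonneg A _)
    (ip_smul_self_le a x)).trans_eq ?_
  rw [norm_smul]
  simp

end LeftAction
section
variable {k : ℕ} (A : Type*) [CStarAlgebra A] [PartialOrder A] [StarOrderedRing A]
  (E : (Fin k → ℕ) → Type*) [∀ n, NormedAddCommGroup (E n)] [∀ n, NormedSpace ℂ (E n)]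
  [∀ n, Module A (E n)] [∀ n, Module Aᵐᵒᵖ (E n)] [∀ n, CStarCorrespondence A (E n)]

/-- The family `E n`, `n ∈ ℕ^k`, of `C*`-correspondences over `A` is a product system.

The semigroup with its homomorphism to `ℕ^k` is the monoid `GradedMonoid E`. The first six
conditions say that `(x, y) ↦ x y` is an `A`-bimodule map that extends to an isomorphism of the
interior tensor product `E n ⊗ E m`, whose inner product is
`⟪x ⊗ y, x' ⊗ y'⟫ = ⟪y, ⟪x, x'⟫ y'⟫`, onto `E (n + m)`: it preserves inner products and has dense
range. The last three say that `a ↦ a • 1` identifies the correspondence `A` with `E 0`. -/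
class ProductSystem [GradedMonoid.GMonoid E] : Prop where
  add_mul {n m : Fin k → ℕ} (x x' : E n) (y : E m) :
    GradedMonoid.GMul.mul (x + x') y = GradedMonoid.GMul.mul x y + GradedMonoid.GMul.mul x' y
  mul_add {n m : Fin k → ℕ} (x : E n) (y y' : E m) :
    GradedMonoid.GMul.mul x (y + y') = GradedMonoid.GMul.mul x y + GradedMonoid.GMul.mul x y'
  smul_mul {n m : Fin k → ℕ} (a : A) (x : E n) (y : E m) :
    GradedMonoid.GMul.mul (a • x) y = a • GradedMonoid.GMul.mul x y
  mul_op_smul {n m : Fin k → ℕ} (a : A) (x : E n) (y : E m) :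
    GradedMonoid.GMul.mul x (op a • y) = op a • GradedMonoid.GMul.mul x y
  ip_mul {n m : Fin k → ℕ} (x x' : E n) (y y' : E m) :
    ip A (GradedMonoid.GMul.mul x y) (GradedMonoid.GMul.mul x' y') = ip A y (ip A x x' • y')
  dense_mul (n m : Fin k → ℕ) :
    Dense (Submodule.span ℂ
      (Set.range fun p : E n × E m => GradedMonoid.GMul.mul p.1 p.2) : Set (E (n + m)))
  smul_one (a : A) : a • (GradedMonoid.GOne.one : E 0) = op a • (GradedMonoid.GOne.one : E 0)
  ip_one : ip A (GradedMonoid.GOne.one : E 0) (GradedMonoid.GOne.one : E 0) = 1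
  exists_smul_one (x : E 0) : ∃ a : A, a • (GradedMonoid.GOne.one : E 0) = x

variable (H : Type*) [NormedAddCommGroup H] [InnerProductSpace ℂ H] [CompleteSpace H]

/-- A representation `(T i, σ)` on `H` of each `E_i = E (e_i)`, with the same `σ`. -/
structure RepTuple where
  σ : A →⋆ₐ[ℂ] (H →L[ℂ] H)
  toFun (i : Fin k) : E (Pi.single i 1) →ₗ[ℂ] (H →L[ℂ] H)
  isCovariantRep (i : Fin k) : IsCovariantRep σ (toFun i)

variable [GradedMonoid.GMonoid E] [ProductSystem A E]

variable {A E H}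

lemma mul_op_smul_balanced {n m : Fin k → ℕ} (a : A) (x : E n) (y : E m) :
    GradedMonoid.GMul.mul (op a • x) y = GradedMonoid.GMul.mul x (a • y) := by
  have h : ∀ x' y', ip A (GradedMonoid.GMul.mul (op a • x) y - GradedMonoid.GMul.mul x (a • y))
      (GradedMonoid.GMul.mul (x' : E n) (y' : E m)) = 0 := by
    intro x' y'
    rw [ip_sub_left, ProductSystem.ip_mul, ProductSystem.ip_mul, ip_op_smul_left,
      ip_lsmul_left, smul_smul, sub_self]
  rw [← sub_eq_zero, ← ip_self_eq_zero A]
  have h2 : ∀ u v w : E (n + m), ip A w u = 0 → ip A w v = 0 → ip A w (u - v) = 0 := by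
    intro u v w hu hv
    rw [← star_ip, ip_sub_left, star_sub, star_ip, star_ip, hu, hv, sub_zero]
  exact h2 _ _ _ (h _ _) (h _ _)

lemma norm_gmul_le (hE : ProductSystem A E) {n m : Fin k → ℕ} (x : E n) (y : E m) :
    ‖(GradedMonoid.GMul.mul x y : E (n + m))‖ ≤ ‖x‖ * ‖y‖ := by
  refine abs_le_of_sq_le_sq' ?_ (by positivity) |>.2
  obtain ⟨b, hb⟩ := aux_star_mul_self _ (ip_self_nonneg A x)
  rw [norm_sq_eq A, hE.ip_mul, hb, ← smul_smul]
  have : ip A y (star b • b • y) = ip A (b • y) (b • y) := by rw [ip_lsmul_left]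
  rw [this, ← norm_sq_eq, mul_pow, norm_sq_eq A x, hb, CStarRing.norm_star_mul_self, ← sq, ← mul_pow]
  gcongr
  exact norm_smul_le_mul b y

lemma complex_smul_gmul (hE : ProductSystem A E) {n m : Fin k → ℕ} (c : ℂ) (x : E n) (y : E m) :
    GradedMonoid.GMul.mul (c • x) y = c • (GradedMonoid.GMul.mul x y : E (n + m)) := by
  have h : ∀ {l} (z : E l), c • z = (c • (1 : A)) • z := fun z => by
    rw [complex_smul_smul, one_smul]
  rw [h x, hE.smul_mul, ← h]

/-- The degree `e_{i_1} + ⋯ + e_{i_r}` of the word `i_1 ⋯ i_r`. -/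
def wordDegree (L : List (Fin k)) : Fin k → ℕ := (L.map fun i => Pi.single i 1).sum

/-- `ξ ∈ E n` is the product `ξ_1 ⋯ ξ_r` of the list `w` of elements `ξ_j ∈ E_{i_j}`, where
`L = i_1 ⋯ i_r`. -/
def IsWordProduct (w : List (Σ i : Fin k, E (Pi.single i 1))) (L : List (Fin k)) {n : Fin k → ℕ}
    (ξ : E n) : Prop :=
  w.map Sigma.fst = L ∧ GradedMonoid.mk n ξ = (w.map fun s => GradedMonoid.mk _ s.2).prod

lemma isWordProduct_snoc {w : List (Σ i : Fin k, E (Pi.single i 1))} {L : List (Fin k)}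
    {i : Fin k} {n : Fin k → ℕ} {ξ : E (n + Pi.single i 1)} (hn : wordDegree L = n)
    (h : IsWordProduct w (L ++ [i]) ξ) :
    ∃ (w' : List (Σ i : Fin k, E (Pi.single i 1))) (x : E n) (y : E (Pi.single i 1)),
      w = w' ++ [⟨i, y⟩] ∧ IsWordProduct w' L x ∧ ξ = GradedMonoid.GMul.mul x y := by
  obtain ⟨h1, h2⟩ := h
  obtain ⟨w', w'', rfl, h3, h4⟩ := List.map_eq_append_iff.mp h1
  obtain ⟨⟨j, y⟩, rfl, rfl⟩ := List.map_eq_singleton_iff.mp h4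
  have hdeg : ((w'.map fun s => GradedMonoid.mk _ s.2).prod : GradedMonoid E).fst = n := by
    rw [← hn, wordDegree, ← h3]
    clear h1 h2 h3 h4
    induction w' with
    | nil => rfl
    | cons s w' ih =>
      simp only [List.map_cons, List.prod_cons, List.sum_cons, GradedMonoid.fst_mul, ih]
      rfl
  obtain ⟨m, x, hx⟩ : ∃ m, ∃ x : E m,
      ((w'.map fun s => GradedMonoid.mk _ s.2).prod : GradedMonoid E) = GradedMonoid.mk m x :=
    ⟨_, _, rfl⟩
  rw [hx] at hdeg
  obtain rfl : m = n := hdeg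
  refine ⟨w', x, y, rfl, ⟨h3, hx.symm⟩, ?_⟩
  rw [List.map_append, List.prod_append, hx] at h2
  simp only [List.map_cons, List.map_nil, List.prod_cons, List.prod_nil, mul_one,
    GradedMonoid.mk_mul_mk] at h2
  exact eq_of_heq (Sigma.mk.inj h2).2

lemma IsWordProduct.snoc {w : List (Σ i : Fin k, E (Pi.single i 1))} {L : List (Fin k)}
    {i : Fin k} {n : Fin k → ℕ} {x : E n} (h : IsWordProduct w L x) (y : E (Pi.single i 1)) :
    IsWordProduct (w ++ [⟨i, y⟩]) (L ++ [i]) (GradedMonoid.GMul.mul x y) := by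
  refine ⟨by simp [h.1], ?_⟩
  rw [List.map_append, List.prod_append, ← h.2]
  simp [GradedMonoid.mk_mul_mk]

lemma dense_wordProduct (L : List (Fin k)) : ∀ (n : Fin k → ℕ), wordDegree L = n →
    Dense (Submodule.span ℂ {z : E n | ∃ w x, IsWordProduct w L x ∧ ∃ a : A, z = op a • x} :
      Set (E n)) := by
  induction L using List.reverseRecOn with
  | nil =>
    rintro n rfl
    intro z
    refine subset_closure (Submodule.subset_span ?_)
    change E 0 at z
    obtain ⟨a, ha⟩ := ProductSystem.exists_smul_one (A := A) z
    exact ⟨[], (GradedMonoid.GOne.one : E 0), ⟨rfl, rfl⟩, a, by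
      rw [← ha, ProductSystem.smul_one]; rfl⟩
  | append_singleton L i ih =>
    rintro n rfl
    have e : wordDegree (L ++ [i]) = wordDegree L + Pi.single i 1 := by simp [wordDegree]
    rw [e]
    set P := (Submodule.span ℂ {z : E (wordDegree L + Pi.single i 1) | ∃ w x,
      IsWordProduct w (L ++ [i]) x ∧ ∃ a : A, z = op a • x}).topologicalClosure with hP
    have hPc : IsClosed (P : Set (E (wordDegree L + Pi.single i 1))) :=
      Submodule.isClosed_topologicalClosure _
    have h1 : ∀ (x : E (wordDegree L)) (y : E (Pi.single i 1)), GradedMonoid.GMul.mul x y ∈ P := by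
      intro x y
      have hcont : Continuous fun x : E (wordDegree L) =>
          (GradedMonoid.GMul.mul x y : E (wordDegree L + Pi.single i 1)) :=
        AddMonoidHomClass.continuous_of_bound
          (AddMonoidHom.mk' (fun x : E (wordDegree L) =>
            (GradedMonoid.GMul.mul x y : E (wordDegree L + Pi.single i 1)))
            fun u v => ProductSystem.add_mul A u v y) ‖y‖
          fun u => (norm_gmul_le (A := A) inferInstance u y).trans_eq (mul_comm _ _)
      have hsub : ((Submodule.span ℂ {z : E (wordDegree L) | ∃ w x, IsWordProduct w L x ∧
          ∃ a : A, z = op a • x} : Submodule ℂ _) : Set (E (wordDegree L)))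
          ⊆ {x | GradedMonoid.GMul.mul x y ∈ P} := by
        intro z hz
        induction hz using Submodule.span_induction with
        | mem z hz =>
          obtain ⟨w, x, hx, a, rfl⟩ := hz
          refine Submodule.le_topologicalClosure _ (Submodule.subset_span ?_)
          refine ⟨_, _, hx.snoc (a • y), 1, ?_⟩
          rw [mul_op_smul_balanced, op_one, one_smul]
        | zero =>
          have : (GradedMonoid.GMul.mul (0 : E (wordDegree L)) y : E (wordDegree L + Pi.single i 1))
              = 0 := by
            have := complex_smul_gmul (A := A) inferInstance 0 (0 : E (wordDegree L)) y
            simpa using this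
          simp [this]
        | add u v _ _ hu hv =>
          simpa [ProductSystem.add_mul A] using P.add_mem hu hv
        | smul c u _ hu => simpa [complex_smul_gmul (A := A) inferInstance] using P.smul_mem c hu
      exact closure_minimal hsub (hPc.preimage hcont) (ih _ rfl x)
    intro z
    have h2 : ((Submodule.span ℂ (Set.range fun p : E (wordDegree L) × E (Pi.single i 1) =>
        GradedMonoid.GMul.mul p.1 p.2) : Submodule ℂ _) : Set (E (wordDegree L + Pi.single i 1)))
        ⊆ P := by
      rw [SetLike.coe_subset_coe, Submodule.span_le]
      rintro _ ⟨p, rfl⟩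
      exact h1 _ _
    exact closure_minimal h2 hPc (ProductSystem.dense_mul (A := A) _ _ z)

theorem RepTuple.exists_tilde_bound (R : RepTuple A E H) (L : List (Fin k)) :
    ∀ (n : Fin k → ℕ), wordDegree L = n → ∃ T : IndTensor R.σ (E n) →L[ℂ] H, ‖T‖ ≤ 1 ∧
      ∀ w ξ, IsWordProduct w L ξ → ∀ h,
        T (tmul R.σ ξ h) = (w.map fun s => R.toFun s.1 s.2).prod h := by
  induction L using List.reverseRecOn with
  | nil =>
    intro n hn
    obtain rfl : n = 0 := hn.symm
    have h1 : ‖creation R.σ (GradedMonoid.GOne.one : E 0)‖ ≤ 1 := by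
      refine ContinuousLinearMap.opNorm_le_bound _ zero_le_one fun h => ?_
      refine (norm_tmul_le _ _ _).trans ?_
      gcongr
      have h2 : ‖(GradedMonoid.GOne.one : E 0)‖ ^ 2 ≤ 1 := by
        rw [norm_sq_eq A, ProductSystem.ip_one]
        rcases subsingleton_or_nontrivial A with hA | hA
        · simp [Subsingleton.elim (1 : A) 0]
        · simp
      nlinarith [norm_nonneg (GradedMonoid.GOne.one : E 0)]
    refine ⟨ContinuousLinearMap.adjoint (creation R.σ (GradedMonoid.GOne.one : E 0)),
      by rwa [LinearIsometryEquiv.norm_map], ?_⟩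
    · rintro w ξ ⟨hw, hξ⟩ h
      obtain rfl : w = [] := by simpa using hw
      obtain rfl : ξ = (GradedMonoid.GOne.one : E 0) := eq_of_heq (Sigma.mk.inj hξ).2
      refine ext_inner_left ℂ fun v => ?_
      rw [ContinuousLinearMap.adjoint_inner_right, creation_apply, inner_tmul,
        ProductSystem.ip_one, map_one]
      simp
  | append_singleton L i ih =>
    rintro n rfl
    have e : wordDegree (L ++ [i]) = wordDegree L + Pi.single i 1 := by simp [wordDegree]
    rw [e]
    obtain ⟨T, hT, hT'⟩ := ih _ rfl
    obtain ⟨S, hS, hS'⟩ := exists_comp (R.isCovariantRep i) T hT GradedMonoid.GMul.mul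
      (fun x y x' y' => ProductSystem.ip_mul x x' y y') (ProductSystem.dense_mul (A := A) _ _)
    refine ⟨S, hS, fun w ξ hw h => ?_⟩
    obtain ⟨w', x, y, rfl, hx, rfl⟩ := isWordProduct_snoc rfl hw
    rw [hS', hT' _ _ hx]
    simp [mul_apply_eq_comp]

theorem RepTuple.existsUnique_tilde (R : RepTuple A E H) (L : List (Fin k)) (n : Fin k → ℕ)
    (hn : wordDegree L = n) : ∃! T : IndTensor R.σ (E n) →L[ℂ] H,
      ∀ w ξ, IsWordProduct w L ξ → ∀ h,
        T (tmul R.σ ξ h) = (w.map fun s => R.toFun s.1 s.2).prod h := by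
  obtain ⟨T, -, hT⟩ := R.exists_tilde_bound L n hn
  refine ⟨T, hT, fun T' hT' => indTensor_ext _ fun ξ h => ?_⟩
  have hcl : IsClosed {ξ : E n | T' (tmul R.σ ξ h) = T (tmul R.σ ξ h)} :=
    isClosed_eq (T'.continuous.comp (continuous_tmul_left _ h))
      (T.continuous.comp (continuous_tmul_left _ h))
  refine closure_minimal ?_ hcl (dense_wordProduct (A := A) L n hn ξ)
  intro z hz
  induction hz using Submodule.span_induction with
  | mem z hz =>
    obtain ⟨w, x, hx, a, rfl⟩ := hz
    simp only [Set.mem_ofPred_eq]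
    rw [op_smul_tmul, hT' _ _ hx, hT _ _ hx]
  | zero => 
    have : tmul R.σ (0 : E n) h = 0 := by simp [tmul]
    simp [this]
  | add u v _ _ hu hv =>
    simp only [Set.mem_ofPred_eq] at hu hv ⊢
    rw [add_tmul, map_add, map_add, hu, hv]
  | smul c u _ hu =>
    simp only [Set.mem_ofPred_eq] at hu ⊢
    rw [smul_tmul, map_smul, map_smul, hu]

/-- For a word `L = i_1 ⋯ i_r` of degree `n`, the operator
`T̃_{i_1} (I ⊗ T̃_{i_2}) ⋯ (I ⊗ ⋯ ⊗ I ⊗ T̃_{i_r})`, where the identification of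
`E_{i_1} ⊗ ⋯ ⊗ E_{i_r}` with `E n` is used to regard it as an operator `E n ⊗ H → H`. It is the
unique bounded operator sending `ξ_1 ⋯ ξ_r ⊗ h` to `T_{i_1}(ξ_1) ⋯ T_{i_r}(ξ_r) h`. -/
noncomputable def RepTuple.wordTilde (R : RepTuple A E H) (L : List (Fin k)) (n : Fin k → ℕ)
    (hn : wordDegree L = n) : IndTensor R.σ (E n) →L[ℂ] H :=
  (R.existsUnique_tilde L n hn).choose

lemma RepTuple.wordTilde_tmul (R : RepTuple A E H) {L : List (Fin k)} {n : Fin k → ℕ}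
    (hn : wordDegree L = n) {w : List (Σ i : Fin k, E (Pi.single i 1))} {ξ : E n}
    (hw : IsWordProduct w L ξ) (h : H) :
    R.wordTilde L n hn (tmul R.σ ξ h) = (w.map fun s => R.toFun s.1 s.2).prod h :=
  (R.existsUnique_tilde L n hn).choose_spec.1 w ξ hw h

lemma RepTuple.wordTilde_unique (R : RepTuple A E H) {L : List (Fin k)} {n : Fin k → ℕ}
    (hn : wordDegree L = n) (T : IndTensor R.σ (E n) →L[ℂ] H)
    (hT : ∀ w ξ, IsWordProduct w L ξ → ∀ h,
      T (tmul R.σ ξ h) = (w.map fun s => R.toFun s.1 s.2).prod h) :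
    T = R.wordTilde L n hn :=
  (R.existsUnique_tilde L n hn).choose_spec.2 T hT

/-- The word `1^{n_1} 2^{n_2} ⋯ k^{n_k}`. -/
def canonicalWord (n : Fin k → ℕ) : List (Fin k) :=
  (List.finRange k).flatMap fun i => List.replicate (n i) i

lemma wordDegree_canonicalWord (n : Fin k → ℕ) : wordDegree (canonicalWord n) = n := by
  have h : ∀ l : List (Fin k), wordDegree (l.flatMap fun i => List.replicate (n i) i)
      = (l.map fun i => Pi.single i (n i)).sum := by
    intro l
    induction l with
    | nil => rfl
    | cons i l ih =>
      rw [List.flatMap_cons, List.map_cons, List.sum_cons, ← ih]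
      simp only [wordDegree, List.map_append, List.sum_append, List.map_replicate,
        List.sum_replicate]
      rw [← Pi.single_smul]
      simp
  rw [canonicalWord, h, ← Fin.sum_univ_def]
  exact Finset.univ_sum_single n

/-- The operator `T̃_n : E n ⊗ H → H`. -/
noncomputable def RepTuple.tilde (R : RepTuple A E H) (n : Fin k → ℕ) :
    IndTensor R.σ (E n) →L[ℂ] H :=
  R.wordTilde (canonicalWord n) n (wordDegree_canonicalWord n)

/-- The map `T_n : E n → B(H)`, `T_n(ξ) h = T̃_n (ξ ⊗ h)`. -/
noncomputable def RepTuple.component (R : RepTuple A E H) (n : Fin k → ℕ) :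
    E n →ₗ[ℂ] (H →L[ℂ] H) where
  toFun ξ := R.tilde n ∘L creation R.σ ξ
  map_add' ξ η := by ext h; simp [add_tmul]
  map_smul' c ξ := by ext h; simp [smul_tmul]

variable (A E H) in
/-- A (completely contractive covariant) representation `(T_1, …, T_k, σ)` of the product system
`E` on `H`. The commutation relation is `T̃_i (I ⊗ T̃_j) = T̃_j (I ⊗ T̃_i) (t_{i,j} ⊗ I)`, where
`t_{i,j} : E_i ⊗ E_j → E_j ⊗ E_i` comes from identifying both sides with `E (e_i + e_j)`. -/
structure Rep extends RepTuple A E H where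
  commute (i j : Fin k) :
    toRepTuple.wordTilde [i, j] (Pi.single i 1 + Pi.single j 1) (by simp [wordDegree]) =
      toRepTuple.wordTilde [j, i] (Pi.single i 1 + Pi.single j 1)
        (by simp [wordDegree, add_comm])

namespace Rep

/-- `(T_1, …, T_k, σ)` is isometric: each `(T_i, σ)` is. -/
def IsIsometric (R : Rep A E H) : Prop := ∀ i, IsIsometricRep R.σ (R.toFun i)

/-- `(T_1, …, T_k, σ)` is fully coisometric: each `(T_i, σ)` is. -/
def IsFullyCoisometric (R : Rep A E H) : Prop := ∀ i, (R.isCovariantRep i).IsFullyCoisometric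

variable {V : Type*} [NormedAddCommGroup V] [InnerProductSpace ℂ V] [CompleteSpace V]

/-- The representation `S` of the product system on `H ⊇ V` is a minimal isometric dilation of the
representation `R` on `V`: each `(S_i, ρ)` dilates `(R_i, σ)`, `S` is isometric, and the vectors
`S_n(ξ) v` with `n ∈ ℕ^k`, `ξ ∈ E n`, `v ∈ V` span a dense subspace of `H`. -/
structure IsMinimalIsometricDilation (ι : V →ₗᵢ[ℂ] H) (R : Rep A E V) (S : Rep A E H) :
    Prop where
  dilation (i : Fin k) : IsDilation ι R.σ (R.toFun i) S.σ (S.toFun i)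
  isometric : S.IsIsometric
  minimal : (Submodule.span ℂ
    {x : H | ∃ (n : Fin k → ℕ) (ξ : E n) (v : V), x = S.component n ξ (ι v)}).topologicalClosure = ⊤

end Rep
end
end CStarCorrespondence

/-! Write `[X]` for closed linear span and identify `V` with its image under `ι`. The point is that
the spaces `[S_m(E(m))V]` increase with `m`. Full coisometry of `(A_i, σ)` says that `Ã_i` maps `z =
Ã_i* v` to `v` with `‖z‖ = ‖v‖`. The isometry `ξ ⊗ u ↦ S_i(ξ)u` followed by the projection onto `V`
is `Ã_i`, so it must send `z` to `v` itself. Hence `V ⊆ [S_i(E_i)V]`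
(`IsDilation.mem_closure_of_isFullyCoisometric`), and applying `S_m(ξ)` gives `[S_m(E(m))V] ⊆
[S_{m+e_i}(E(m+e_i))V]`. If every `n_i` is nonzero, the multiples `N n` are cofinal in `ℕ^k`. So the
vectors obtained from powers of `S_n` alone already span everything that the dilation of the product
system spans, which is minimality.

That `(S_n, ρ)` is an isometric dilation of `(A_n, σ)` follows from the generators once `T_{n+m}(xy)
= T_n(x)T_m(y)` is known (`Rep.component_mul`). This needs `T_n` to be independent of the order of
the letters in a word of degree `n` (`Rep.wordMap_perm`), the only place where the commutation
relations enter.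

Uniqueness holds for minimal isometric dilations of any single correspondence: the inner products of
the spanning vectors `S(ξ_1)⋯S(ξ_r)v` are determined by `(T, σ)`, and total families with equal Gram
matrices are unitarily equivalent. -/

namespace CStarCorrespondence

/-! ### Representations of a correspondence and contractions on the interior tensor product -/

section Correspondence
variable {A : Type*} [CStarAlgebra A] [PartialOrder A] [StarOrderedRing A]
  {H : Type*} [NormedAddCommGroup H] [InnerProductSpace ℂ H] [CompleteSpace H]
  {σ : A →⋆ₐ[ℂ] (H →L[ℂ] H)}
  {E : Type*} [NormedAddCommGroup E] [NormedSpace ℂ E] [Module A E] [Module Aᵐᵒᵖ E]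
  [CStarCorrespondence A E]

variable (σ) in
/-- The operator `ξ ↦ ξ ⊗ h`. -/
noncomputable def tmulRight (h : H) : E →L[ℂ] IndTensor σ E :=
  ⟨⟨⟨fun ξ => tmul σ ξ h, fun ξ η => add_tmul σ ξ η h⟩, fun c ξ => smul_tmul σ c ξ h⟩,
    continuous_tmul_left σ h⟩

@[simp] lemma tmulRight_apply (h : H) (ξ : E) : tmulRight σ h ξ = tmul σ ξ h := rfl

lemma lsmul_complex_smul (a : A) (c : ℂ) (x : E) : a • c • x = c • a • x := by
  have h (z : E) : c • z = (c • (1 : A)) • z := by rw [complex_smul_smul, one_smul]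
  rw [h x, h (a • x), smul_smul, smul_smul]
  simp

variable (E) in
/-- The left action of an element of `A` as a bounded operator. -/
noncomputable def lsmulCLM (a : A) : E →L[ℂ] E :=
  LinearMap.mkContinuous ⟨⟨fun x => a • x, fun x y => smul_add a x y⟩,
    fun c x => lsmul_complex_smul a c x⟩ ‖a‖ (norm_smul_le_mul a)

@[simp] lemma lsmulCLM_apply (a : A) (x : E) : lsmulCLM E a x = a • x := rfl

/-- In the `C*`-algebra of matrices, `‖G‖ • 1 - G` is positive, hence of the form `D* D`, and its
quadratic form at `h` is a sum of squares. The quadratic form of `G` is the left-hand side. Through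
this bound, contractivity of one operator on `E ⊗_σ H` yields complete contractivity. -/
lemma sum_norm_tmul_le {N : ℕ} (ξ : Matrix (Fin N) (Fin N) E) (h : Fin N → H) :
    ∑ i, ‖∑ j, tmul σ (ξ i j) (h j)‖ ^ 2 ≤
      ‖(CStarMatrix.ofMatrix fun i j => ∑ k, ip A (ξ k i) (ξ k j) :
        CStarMatrix (Fin N) (Fin N) A)‖ * ∑ j, ‖h j‖ ^ 2 := by
  set G : CStarMatrix (Fin N) (Fin N) A :=
    CStarMatrix.ofMatrix fun i j => ∑ k, ip A (ξ k i) (ξ k j) with hG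
  have hGs : IsSelfAdjoint G := by
    ext i j
    change star (∑ k, ip A (ξ k j) (ξ k i)) = ∑ k, ip A (ξ k i) (ξ k j)
    simp [star_ip]
  have h1 : 0 ≤ ((‖G‖ : ℝ) : ℂ) • (1 : CStarMatrix (Fin N) (Fin N) A) - G := by
    have := hGs.le_algebraMap_norm_self
    rw [sub_nonneg]
    simpa [Algebra.algebraMap_eq_smul_one] using this
  obtain ⟨D, hD⟩ := aux_star_mul_self _ h1
  have h2 := sum_inner_gram σ _ D hD h
  have h3 : ∑ i, ∑ j, ⟪h i, σ ((((‖G‖ : ℝ) : ℂ) • (1 : CStarMatrix (Fin N) (Fin N) A) - G) i j)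
      (h j)⟫_ℂ = (‖G‖ : ℂ) * ∑ i, (‖h i‖ : ℂ) ^ 2 - ∑ i, ∑ j, ⟪h i, σ (G i j) (h j)⟫_ℂ := by
    rw [Finset.mul_sum, ← Finset.sum_sub_distrib]
    refine Finset.sum_congr rfl fun i _ => ?_
    rw [eq_sub_iff_add_eq, ← Finset.sum_add_distrib]
    have h4 (j : Fin N) : ⟪h i, σ ((((‖G‖ : ℝ) : ℂ) • (1 : CStarMatrix (Fin N) (Fin N) A) - G) i j)
        (h j)⟫_ℂ + ⟪h i, σ (G i j) (h j)⟫_ℂ = if i = j then (‖G‖ : ℂ) * (‖h i‖ : ℂ) ^ 2 else 0 := by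
      rw [← inner_add_right, ← add_apply, ← map_add, CStarMatrix.sub_apply,
        sub_add_cancel, CStarMatrix.smul_apply, CStarMatrix.one_apply]
      split_ifs with hij
      · subst hij
        have := inner_self_eq_norm_sq_to_K (𝕜 := ℂ) (h i)
        rw [RCLike.ofReal_eq_complex_ofReal] at this
        rw [map_smul, map_one, smul_apply, one_apply_eq_self, inner_smul_right, this]
      · simp
    simp only [h4, Finset.sum_ite_eq, Finset.mem_univ, if_true]
  -- `G` is the sum over `k` of the Gram matrices of the rows of `ξ`.
  have h5 : ∑ i, ∑ j, ⟪h i, σ (G i j) (h j)⟫_ℂ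
      = ∑ k, (‖∑ j, tmul σ (ξ k j) (h j)‖ : ℂ) ^ 2 := by
    simp only [norm_sum_tmul_sq]
    conv_rhs => rw [Finset.sum_comm]
    refine Finset.sum_congr rfl fun i _ => ?_
    conv_rhs => rw [Finset.sum_comm]
    refine Finset.sum_congr rfl fun j _ => ?_
    rw [← inner_sum, ← sum_apply, ← map_sum]
    rfl
  rw [h3, h5] at h2
  have h6 : ‖G‖ * ∑ i, ‖h i‖ ^ 2 - ∑ k, ‖∑ j, tmul σ (ξ k j) (h j)‖ ^ 2
      = ∑ k, ‖∑ j, σ (D k j) (h j)‖ ^ 2 := by exact_mod_cast h2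
  have h7 : 0 ≤ ∑ k, ‖∑ j, σ (D k j) (h j)‖ ^ 2 := Finset.sum_nonneg fun _ _ => by positivity
  linarith

/-- A contraction on `E ⊗_σ H` that intertwines the left actions gives a completely contractive
covariant representation. -/
lemma isCovariantRep_of_contraction {T : E →ₗ[ℂ] (H →L[ℂ] H)} (S : IndTensor σ E →L[ℂ] H)
    (hS : ‖S‖ ≤ 1) (hT : ∀ ξ h, T ξ h = S (tmul σ ξ h))
    (hleft : ∀ (a : A) ξ h, T (a • ξ) h = σ a (T ξ h)) : IsCovariantRep σ T where
  covariant a b ξ := by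
    ext h
    rw [hleft, hT, op_smul_tmul, ← hT]
    rfl
  completelyContractive N ξ h := by
    refine le_trans (Finset.sum_le_sum fun i _ => ?_) (sum_norm_tmul_le (σ := σ) ξ h)
    simp only [hT, ← map_sum]
    gcongr
    exact (S.le_opNorm _).trans (mul_le_of_le_one_left (norm_nonneg _) hS)

lemma IsIsometricRep.inner_map {T : E →ₗ[ℂ] (H →L[ℂ] H)} (hT : IsIsometricRep σ T) (ξ η : E)
    (h k : H) : ⟪T ξ h, T η k⟫_ℂ = ⟪h, σ (ip A ξ η) k⟫_ℂ := by
  rw [← hT, ContinuousLinearMap.comp_apply, ContinuousLinearMap.adjoint_inner_right]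

end Correspondence

/-! ### Words in the generators and the operators attached to them -/

section ProductSystem
variable {k : ℕ} {A : Type*} [CStarAlgebra A] [PartialOrder A] [StarOrderedRing A]
  {E : (Fin k → ℕ) → Type*} [∀ n, NormedAddCommGroup (E n)] [∀ n, NormedSpace ℂ (E n)]
  [∀ n, Module A (E n)] [∀ n, Module Aᵐᵒᵖ (E n)] [∀ n, CStarCorrespondence A (E n)]
  [GradedMonoid.GMonoid E] [ProductSystem A E]
  {H : Type*} [NormedAddCommGroup H] [InnerProductSpace ℂ H] [CompleteSpace H]

lemma ext_gmul (hE : ProductSystem A E) {𝕜 K : Type*} [NontriviallyNormedField 𝕜] [NormedAddCommGroup K] [NormedSpace 𝕜 K]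
    {τ : ℂ →+* 𝕜} {n m : Fin k → ℕ} {f g : E (n + m) →SL[τ] K}
    (h : ∀ (x : E n) (y : E m), f (GradedMonoid.GMul.mul x y) = g (GradedMonoid.GMul.mul x y)) :
    f = g := by
  refine ContinuousLinearMap.ext_on (hE.dense_mul n m) ?_
  rintro _ ⟨p, rfl⟩
  exact h p.1 p.2

/-- The degree of a product of generators depends only on its word, so the two segments of `w`
multiply out to elements of the prescribed fibres `E n` and `E m`. -/
lemma isWordProduct_append {w : List (Σ i : Fin k, E (Pi.single i 1))} {L L' : List (Fin k)}
    {n m : Fin k → ℕ} {ξ : E (n + m)} (hn : wordDegree L = n) (hm : wordDegree L' = m)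
    (h : IsWordProduct w (L ++ L') ξ) :
    ∃ (w₁ w₂ : List (Σ i : Fin k, E (Pi.single i 1))) (x : E n) (y : E m),
      w = w₁ ++ w₂ ∧ IsWordProduct w₁ L x ∧ IsWordProduct w₂ L' y ∧
        ξ = GradedMonoid.GMul.mul x y := by
  obtain ⟨h1, h2⟩ := h
  obtain ⟨w₁, w₂, rfl, h3, h4⟩ := List.map_eq_append_iff.mp h1
  have hdeg (w : List (Σ i : Fin k, E (Pi.single i 1))) :
      ((w.map fun s => GradedMonoid.mk _ s.2).prod : GradedMonoid E).fst
        = wordDegree (w.map Sigma.fst) := by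
    induction w with
    | nil => rfl
    | cons s w ih =>
      simp only [List.map_cons, List.prod_cons, GradedMonoid.fst_mul, ih, wordDegree,
        List.sum_cons]
      rfl
  have hex (w : List (Σ i : Fin k, E (Pi.single i 1))) (l : Fin k → ℕ)
      (hl : wordDegree (w.map Sigma.fst) = l) : ∃ x : E l,
      GradedMonoid.mk l x = (w.map fun s => GradedMonoid.mk _ s.2).prod := by
    obtain rfl := (hdeg w).trans hl
    exact ⟨_, rfl⟩
  obtain ⟨x, hx⟩ := hex w₁ n (by rw [h3, hn])
  obtain ⟨y, hy⟩ := hex w₂ m (by rw [h4, hm])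
  refine ⟨w₁, w₂, x, y, rfl, ⟨h3, hx⟩, ⟨h4, hy⟩, ?_⟩
  rw [List.map_append, List.prod_append, ← hx, ← hy, GradedMonoid.mk_mul_mk] at h2
  exact eq_of_heq (Sigma.mk.inj h2).2

lemma wordDegree_append (L L' : List (Fin k)) :
    wordDegree (L ++ L') = wordDegree L + wordDegree L' := by simp [wordDegree]

lemma wordDegree_apply (L : List (Fin k)) (i : Fin k) : wordDegree L i = L.count i := by
  induction L with
  | nil => rfl
  | cons j L ih =>
    have : wordDegree (j :: L) = Pi.single j 1 + wordDegree L := by simp [wordDegree]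
    rw [this, Pi.add_apply, ih, List.count_cons, add_comm, Pi.single_apply]
    congr 1
    exact if_congr (by rw [beq_iff_eq, eq_comm]) rfl rfl

/-- The degree records how often each letter occurs. -/
lemma perm_of_wordDegree_eq {L L' : List (Fin k)} (h : wordDegree L = wordDegree L') :
    L.Perm L' := by
  rw [List.perm_iff_count]
  intro i
  rw [← wordDegree_apply, h, wordDegree_apply]

namespace RepTuple

/-- The operators `T_L(ξ) h = T̃_L (ξ ⊗ h)` of a word `L` of degree `n`. -/
noncomputable def wordMap (R : RepTuple A E H) (L : List (Fin k)) (n : Fin k → ℕ)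
    (hn : wordDegree L = n) : E n →ₗ[ℂ] (H →L[ℂ] H) where
  toFun ξ := R.wordTilde L n hn ∘L creation R.σ ξ
  map_add' ξ η := by ext h; simp [add_tmul]
  map_smul' c ξ := by ext h; simp [smul_tmul]

variable (R : RepTuple A E H)

lemma wordMap_apply {L : List (Fin k)} {n : Fin k → ℕ} (hn : wordDegree L = n) (ξ : E n) (h : H) :
    R.wordMap L n hn ξ h = R.wordTilde L n hn (tmul R.σ ξ h) := rfl

/-- The operator `ξ ↦ T_L(ξ) h`. -/
noncomputable def wordEval (L : List (Fin k)) (n : Fin k → ℕ) (hn : wordDegree L = n) (h : H) :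
    E n →L[ℂ] H := R.wordTilde L n hn ∘L tmulRight R.σ h

@[simp] lemma wordEval_apply {L : List (Fin k)} {n : Fin k → ℕ} (hn : wordDegree L = n) (ξ : E n)
    (h : H) : R.wordEval L n hn h ξ = R.wordMap L n hn ξ h := rfl

lemma norm_wordTilde_le (L : List (Fin k)) (n : Fin k → ℕ) (hn : wordDegree L = n) :
    ‖R.wordTilde L n hn‖ ≤ 1 := by
  obtain ⟨T, hT, hT'⟩ := R.exists_tilde_bound L n hn
  rwa [← R.wordTilde_unique hn T hT']

/-- `exists_comp` produces a bounded operator with `xy ⊗ h ↦ T_L(x) T_{L'}(y) h`; it has the right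
values on word products, so uniqueness identifies it with `T̃_{LL'}`. Covariance of `T_{L'}` is a
hypothesis here because its proof for general words uses this lemma with `L'` a single letter. -/
lemma wordMap_append_of_isCovariantRep {L L' : List (Fin k)} {n m : Fin k → ℕ}
    (hn : wordDegree L = n) (hm : wordDegree L' = m) (hLL' : wordDegree (L ++ L') = n + m)
    (hcov : IsCovariantRep R.σ (R.wordMap L' m hm)) (x : E n) (y : E m) :
    R.wordMap (L ++ L') (n + m) hLL' (GradedMonoid.GMul.mul x y)
      = R.wordMap L n hn x * R.wordMap L' m hm y := by
  obtain ⟨S, -, hS⟩ := exists_comp hcov (R.wordTilde L n hn) (R.norm_wordTilde_le L n hn)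
    GradedMonoid.GMul.mul (fun x y x' y' => ProductSystem.ip_mul x x' y y')
    (ProductSystem.dense_mul (A := A) _ _)
  have := R.wordTilde_unique hLL' S fun w ξ hw h => by
    obtain ⟨w₁, w₂, x, y, rfl, hx, hy, rfl⟩ := isWordProduct_append hn hm hw
    rw [hS, R.wordTilde_tmul hn hx, R.wordMap_apply, R.wordTilde_tmul hm hy]
    simp [mul_apply_eq_comp]
  ext h
  rw [wordMap_apply, ← this, hS]
  rfl

lemma isWordProduct_singleton (i : Fin k) (ξ : E (Pi.single i 1)) :
    IsWordProduct [⟨i, ξ⟩] [i] ξ := by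
  refine ⟨rfl, ?_⟩
  simp

lemma wordMap_singleton (i : Fin k) (hn : wordDegree [i] = Pi.single i 1) :
    R.wordMap [i] (Pi.single i 1) hn = R.toFun i := by
  ext ξ h
  rw [wordMap_apply, R.wordTilde_tmul hn (isWordProduct_singleton i ξ)]
  simp

lemma wordMap_nil_smul_one (hn : wordDegree ([] : List (Fin k)) = 0) (a : A) :
    R.wordMap [] 0 hn (a • (GradedMonoid.GOne.one : E 0)) = R.σ a := by
  ext h
  rw [wordMap_apply, ProductSystem.smul_one, op_smul_tmul,
    R.wordTilde_tmul hn (w := []) ⟨rfl, rfl⟩]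
  simp

/-- The last letter is split off, since covariance of a single letter is given; then `a(xy) = (ax)y`
moves `a` onto the shorter word. -/
lemma wordMap_smul (L : List (Fin k)) : ∀ (n : Fin k → ℕ) (hn : wordDegree L = n) (a : A) (ξ : E n)
    (h : H), R.wordMap L n hn (a • ξ) h = R.σ a (R.wordMap L n hn ξ h) := by
  induction L using List.reverseRecOn with
  | nil =>
    intro n hn a ξ h
    obtain rfl : n = 0 := hn.symm
    obtain ⟨b, rfl⟩ := ProductSystem.exists_smul_one (A := A) ξ
    rw [smul_smul, wordMap_nil_smul_one, wordMap_nil_smul_one, map_mul, mul_apply_eq_comp]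
  | append_singleton L i ih =>
    intro n hn a ξ h
    have hi : wordDegree [i] = Pi.single i 1 := by simp [wordDegree]
    obtain rfl : wordDegree L + Pi.single i 1 = n := by rw [← hn, wordDegree_append, hi]
    have hcov : IsCovariantRep R.σ (R.wordMap [i] _ hi) := by
      rw [wordMap_singleton]; exact R.isCovariantRep i
    have := ext_gmul (A := A) inferInstance (f := R.wordEval (L ++ [i]) _ hn h ∘L lsmulCLM _ a)
      (g := R.σ a ∘L R.wordEval (L ++ [i]) _ hn h) (fun x y => by
        simp only [ContinuousLinearMap.comp_apply, lsmulCLM_apply, wordEval_apply]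
        rw [← ProductSystem.smul_mul, R.wordMap_append_of_isCovariantRep rfl hi hn hcov,
          R.wordMap_append_of_isCovariantRep rfl hi hn hcov, mul_apply_eq_comp,
          mul_apply_eq_comp, ih])
    exact DFunLike.congr_fun this ξ

lemma isCovariantRep_wordMap (L : List (Fin k)) (n : Fin k → ℕ) (hn : wordDegree L = n) :
    IsCovariantRep R.σ (R.wordMap L n hn) :=
  isCovariantRep_of_contraction _ (R.norm_wordTilde_le L n hn) (fun _ _ => rfl)
    (R.wordMap_smul L n hn)

lemma wordMap_append {L L' : List (Fin k)} {n m : Fin k → ℕ}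
    (hn : wordDegree L = n) (hm : wordDegree L' = m) (hLL' : wordDegree (L ++ L') = n + m)
    (x : E n) (y : E m) :
    R.wordMap (L ++ L') (n + m) hLL' (GradedMonoid.GMul.mul x y)
      = R.wordMap L n hn x * R.wordMap L' m hm y :=
  R.wordMap_append_of_isCovariantRep hn hm hLL' (R.isCovariantRep_wordMap L' m hm) x y

/-- Isometry means that `T̃_L` preserves inner products. On products, isometry of `T_L` and then of
`T_i` gives `⟪h, σ⟪y, ⟪x, x'⟫ y'⟫ h'⟫`, the inner product of `xy ⊗ h` and `x'y' ⊗ h'`. -/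
lemma isIsometricRep_wordMap (hR : ∀ i, IsIsometricRep R.σ (R.toFun i)) (L : List (Fin k)) :
    ∀ (n : Fin k → ℕ) (hn : wordDegree L = n), IsIsometricRep R.σ (R.wordMap L n hn) := by
  induction L using List.reverseRecOn with
  | nil =>
    intro n hn ξ η
    obtain rfl : n = 0 := hn.symm
    obtain ⟨a, rfl⟩ := ProductSystem.exists_smul_one (A := A) ξ
    obtain ⟨b, rfl⟩ := ProductSystem.exists_smul_one (A := A) η
    rw [wordMap_nil_smul_one, wordMap_nil_smul_one, ProductSystem.smul_one a,
      ProductSystem.smul_one b, ip_op_smul_left, ip_op_smul_right, ProductSystem.ip_one, one_mul,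
      map_mul, map_star]
    rfl
  | append_singleton L i ih =>
    intro n hn ξ η
    have hi : wordDegree [i] = Pi.single i 1 := by simp [wordDegree]
    obtain rfl : wordDegree L + Pi.single i 1 = n := by rw [← hn, wordDegree_append, hi]
    have key (x x' : E (wordDegree L)) (y y' : E (Pi.single i 1)) (h h' : H) :
        ⟪R.wordMap (L ++ [i]) _ hn (GradedMonoid.GMul.mul x y) h,
          R.wordMap (L ++ [i]) _ hn (GradedMonoid.GMul.mul x' y') h'⟫_ℂ
        = ⟪tmul R.σ (GradedMonoid.GMul.mul x y) h,
          tmul R.σ (GradedMonoid.GMul.mul x' y') h'⟫_ℂ := by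
      rw [R.wordMap_append rfl hi, R.wordMap_append rfl hi, wordMap_singleton, mul_apply_eq_comp,
        mul_apply_eq_comp, (ih _ rfl).inner_map, ← mul_apply_eq_comp (R.σ _),
        ← (R.isCovariantRep i).map_smul_left, (hR i).inner_map, inner_tmul, ProductSystem.ip_mul]
    -- Density extends the identity from products to all elements, one argument at a time.
    -- Conjugation in `h2` puts the argument still to be extended in the linear slot.
    have h1 (x : E (wordDegree L)) (y : E (Pi.single i 1)) (η : E (wordDegree L + Pi.single i 1))
        (h h' : H) :
        ⟪R.wordMap (L ++ [i]) _ hn (GradedMonoid.GMul.mul x y) h,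
          R.wordMap (L ++ [i]) _ hn η h'⟫_ℂ
        = ⟪tmul R.σ (GradedMonoid.GMul.mul x y) h, tmul R.σ η h'⟫_ℂ :=
      DFunLike.congr_fun (ext_gmul (A := A) inferInstance
        (f := innerSL ℂ (R.wordMap (L ++ [i]) _ hn (GradedMonoid.GMul.mul x y) h) ∘L
          R.wordEval (L ++ [i]) _ hn h')
        (g := innerSL ℂ (tmul R.σ (GradedMonoid.GMul.mul x y) h) ∘L tmulRight R.σ h')
        fun x' y' => key x x' y y' h h') η
    have h2 (h h' : H) : ⟪R.wordMap (L ++ [i]) _ hn η h', R.wordMap (L ++ [i]) _ hn ξ h⟫_ℂ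
        = ⟪tmul R.σ η h', tmul R.σ ξ h⟫_ℂ :=
      DFunLike.congr_fun (ext_gmul (A := A) inferInstance
        (f := innerSL ℂ (R.wordMap (L ++ [i]) _ hn η h') ∘L R.wordEval (L ++ [i]) _ hn h)
        (g := innerSL ℂ (tmul R.σ η h') ∘L tmulRight R.σ h) fun x y => by
          simpa using congrArg (starRingEnd ℂ) (h1 x y η h h')) ξ
    ext h'
    refine ext_inner_left ℂ fun h => ?_
    rw [ContinuousLinearMap.comp_apply, ContinuousLinearMap.adjoint_inner_right, ← inner_tmul]
    simpa using congrArg (starRingEnd ℂ) (h2 h h')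

end RepTuple

/-! ### Independence of the order of the letters and multiplicativity of the components -/

namespace Rep
variable (R : Rep A E H)

/-- Permutations are generated by swaps of the two leading letters and by prefixing a letter. The
commutation relation settles the two-letter word, and multiplicativity over concatenation carries
the equality to longer words. -/
lemma wordMap_perm {L L' : List (Fin k)} (hLL' : L.Perm L') : ∀ (n : Fin k → ℕ)
    (hn : wordDegree L = n) (hn' : wordDegree L' = n), R.wordMap L n hn = R.wordMap L' n hn' := by
  induction hLL' with
  | nil => intros; rfl
  | @cons i L L' _ ih =>
    intro n hn hn'
    have hi : wordDegree [i] = Pi.single i 1 := by simp [wordDegree]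
    obtain rfl : Pi.single i 1 + wordDegree L = n := by
      rw [← hn, ← List.singleton_append, wordDegree_append, hi]
    have hd : wordDegree L' = wordDegree L := by
      rw [← List.singleton_append, wordDegree_append, hi] at hn'
      exact add_left_cancel hn'
    ext ξ h
    refine DFunLike.congr_fun (ext_gmul (A := A) inferInstance (f := R.wordEval (i :: L) _ hn h)
      (g := R.wordEval (i :: L') _ hn' h) fun x y => ?_) ξ
    rw [RepTuple.wordEval_apply, RepTuple.wordEval_apply]
    have e1 := R.wordMap_append hi rfl hn x y
    have e2 := R.wordMap_append hi hd hn' x y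
    simp only [List.singleton_append] at e1 e2
    rw [e1, e2, ih _ rfl hd]
  | swap i j L =>
    intro n hn hn'
    have hji : wordDegree [j, i] = Pi.single j 1 + Pi.single i 1 := by simp [wordDegree]
    have hij : wordDegree [i, j] = Pi.single j 1 + Pi.single i 1 := by
      simp [wordDegree, add_comm]
    obtain rfl : (Pi.single j 1 + Pi.single i 1) + wordDegree L = n := by
      rw [← hn, ← hji, ← wordDegree_append]; rfl
    ext ξ h
    refine DFunLike.congr_fun (ext_gmul (A := A) inferInstance (f := R.wordEval (j :: i :: L) _ hn h)
      (g := R.wordEval (i :: j :: L) _ hn' h) fun x y => ?_) ξ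
    rw [RepTuple.wordEval_apply, RepTuple.wordEval_apply]
    have e1 := R.wordMap_append (L := [j, i]) hji rfl hn x y
    have e2 := R.wordMap_append (L := [i, j]) hij rfl hn' x y
    simp only [List.cons_append, List.nil_append] at e1 e2
    rw [e1, e2]
    have e : R.wordMap [j, i] _ hji x = R.wordMap [i, j] _ hij x := by
      ext u
      rw [RepTuple.wordMap_apply, R.commute j i]
      rfl
    rw [e]
  | trans h₁ _ ih₁ ih₂ =>
    intro n hn hn'
    have h2 : wordDegree _ = n := ((h₁.map _).sum_eq.symm.trans hn :)
    rw [ih₁ n hn h2, ih₂ n h2 hn']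

/-- This frees `T_n` from the canonical word. It is needed because the concatenation of two
canonical words is in general not canonical. -/
lemma component_eq_wordMap {L : List (Fin k)} {n : Fin k → ℕ} (hn : wordDegree L = n) :
    R.component n = R.wordMap L n hn :=
  R.wordMap_perm (perm_of_wordDegree_eq ((wordDegree_canonicalWord n).trans hn.symm)) n
    (wordDegree_canonicalWord n) hn

lemma component_mul {n m : Fin k → ℕ} (x : E n) (y : E m) :
    R.component (n + m) (GradedMonoid.GMul.mul x y) = R.component n x * R.component m y := by
  have hn := wordDegree_canonicalWord n
  have hm := wordDegree_canonicalWord m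
  have h : wordDegree (canonicalWord n ++ canonicalWord m) = n + m := by
    rw [wordDegree_append, hn, hm]
  rw [R.component_eq_wordMap h, R.wordMap_append hn hm]
  rfl

lemma component_single (i : Fin k) : R.component (Pi.single i 1) = R.toFun i := by
  have hi : wordDegree [i] = Pi.single i 1 := by simp [wordDegree]
  rw [R.component_eq_wordMap hi, RepTuple.wordMap_singleton]

lemma component_zero (a : A) :
    R.component 0 (a • (GradedMonoid.GOne.one : E 0)) = R.σ a := by
  have h0 : wordDegree ([] : List (Fin k)) = 0 := rfl
  rw [R.component_eq_wordMap h0, RepTuple.wordMap_nil_smul_one]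

lemma isCovariantRep_component (n : Fin k → ℕ) : IsCovariantRep R.σ (R.component n) :=
  R.isCovariantRep_wordMap (canonicalWord n) n (wordDegree_canonicalWord n)

lemma IsIsometric.component {R : Rep A E H} (hR : R.IsIsometric) (n : Fin k → ℕ) :
    IsIsometricRep R.σ (R.component n) :=
  R.isIsometricRep_wordMap hR (canonicalWord n) n (wordDegree_canonicalWord n)

/-- The operator `ξ ↦ T_n(ξ) h`. -/
noncomputable def componentEval (n : Fin k → ℕ) (h : H) : E n →L[ℂ] H :=
  R.wordEval (canonicalWord n) n (wordDegree_canonicalWord n) h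

@[simp] lemma componentEval_apply (n : Fin k → ℕ) (h : H) (ξ : E n) :
    R.componentEval n h ξ = R.component n ξ h := rfl

end Rep
end ProductSystem
-- Families of vectors with equal Gram matrices
section Gram
variable {K : Type*} [NormedAddCommGroup K] [InnerProductSpace ℂ K] [CompleteSpace K]
  {L : Type*} [NormedAddCommGroup L] [InnerProductSpace ℂ L] [CompleteSpace L]

/-- The norm of a linear combination depends only on the coefficients and the Gram matrix. Hence `∑
c_p f(p) ↦ ∑ c_p g(p)` is well defined and isometric on a dense subspace. -/
lemma exists_contraction_of_gram_eq {X : Type*} {f : X → K} {g : X → L}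
    (hfg : ∀ p q, ⟪f p, f q⟫_ℂ = ⟪g p, g q⟫_ℂ)
    (hf : (Submodule.span ℂ (Set.range f)).topologicalClosure = ⊤) :
    ∃ T : K →L[ℂ] L, ‖T‖ ≤ 1 ∧ ∀ p, T (f p) = g p := by
  obtain ⟨T, hT, hT'⟩ := exists_extension (Finsupp.linearCombination ℂ f)
    (Finsupp.linearCombination ℂ g)
    (by
      rw [DenseRange, ← LinearMap.coe_range, Finsupp.range_linearCombination]
      exact Submodule.dense_iff_topologicalClosure_eq_top.mpr hf)
    (fun c => le_of_eq <| by
      have : ⟪Finsupp.linearCombination ℂ g c, Finsupp.linearCombination ℂ g c⟫_ℂ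
          = ⟪Finsupp.linearCombination ℂ f c, Finsupp.linearCombination ℂ f c⟫_ℂ := by
        simp only [Finsupp.linearCombination_apply, Finsupp.sum, sum_inner, inner_sum,
          inner_smul_left, inner_smul_right, hfg]
      rw [norm_eq_sqrt_re_inner (𝕜 := ℂ), norm_eq_sqrt_re_inner (𝕜 := ℂ), this])
  exact ⟨T, hT, fun p => by simpa using hT' (Finsupp.single p 1)⟩

/-- Two total families with the same Gram matrix are unitarily equivalent. -/
lemma exists_unitary_of_gram_eq {X : Type*} {f : X → K} {g : X → L}
    (hfg : ∀ p q, ⟪f p, f q⟫_ℂ = ⟪g p, g q⟫_ℂ)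
    (hf : (Submodule.span ℂ (Set.range f)).topologicalClosure = ⊤)
    (hg : (Submodule.span ℂ (Set.range g)).topologicalClosure = ⊤) :
    ∃ U : K ≃ₗᵢ[ℂ] L, ∀ p, U (f p) = g p := by
  obtain ⟨T, hT, hTf⟩ := exists_contraction_of_gram_eq hfg hf
  obtain ⟨T', hT', hTg⟩ := exists_contraction_of_gram_eq (fun p q => (hfg p q).symm) hg
  have h1 : T' ∘L T = ContinuousLinearMap.id ℂ K := by
    refine ContinuousLinearMap.ext_on (Submodule.dense_iff_topologicalClosure_eq_top.mpr hf) ?_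
    rintro _ ⟨p, rfl⟩
    simp [hTf, hTg]
  have h2 : T ∘L T' = ContinuousLinearMap.id ℂ L := by
    refine ContinuousLinearMap.ext_on (Submodule.dense_iff_topologicalClosure_eq_top.mpr hg) ?_
    rintro _ ⟨p, rfl⟩
    simp [hTf, hTg]
  have e1 (x : K) : T' (T x) = x := DFunLike.congr_fun h1 x
  have e2 (x : L) : T (T' x) = x := DFunLike.congr_fun h2 x
  refine ⟨⟨LinearEquiv.ofLinearMap T.toLinearMap T'.toLinearMap
    (LinearMap.ext e2) (LinearMap.ext e1), fun x => le_antisymm ?_ ?_⟩, hTf⟩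
  · exact (T.le_opNorm x).trans (mul_le_of_le_one_left (norm_nonneg _) hT)
  · have := (T'.le_opNorm (T x)).trans (mul_le_of_le_one_left (norm_nonneg _) hT')
    rwa [e1] at this

end Gram

/-! ### Dilations of a single correspondence -/

section Dilation
variable {A : Type*} [CStarAlgebra A] [PartialOrder A] [StarOrderedRing A]
  {V : Type*} [NormedAddCommGroup V] [InnerProductSpace ℂ V] [CompleteSpace V]
  {H : Type*} [NormedAddCommGroup H] [InnerProductSpace ℂ H] [CompleteSpace H]
  {E : Type*} [NormedAddCommGroup E] [NormedSpace ℂ E] [Module A E] [Module Aᵐᵒᵖ E]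
  [CStarCorrespondence A E]
  {ι : V →ₗᵢ[ℂ] H} {σ : A →⋆ₐ[ℂ] (V →L[ℂ] V)} {T : E →ₗ[ℂ] (V →L[ℂ] V)}
  {ρ : A →⋆ₐ[ℂ] (H →L[ℂ] H)} {S : E →ₗ[ℂ] (H →L[ℂ] H)}

lemma adjoint_isometry_apply (v : V) :
    ContinuousLinearMap.adjoint ι.toContinuousLinearMap (ι v) = v := by
  refine ext_inner_left ℂ fun w => ?_
  rw [ContinuousLinearMap.adjoint_inner_right]
  exact ι.inner_map_map w v

lemma mem_range_orthogonal_iff {x : H} : x ∈ (LinearMap.range ι.toLinearMap)ᗮ ↔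
    ContinuousLinearMap.adjoint ι.toContinuousLinearMap x = 0 := by
  rw [Submodule.mem_orthogonal]
  constructor
  · intro h
    refine ext_inner_left ℂ fun w => ?_
    rw [ContinuousLinearMap.adjoint_inner_right, inner_zero_right]
    exact h _ ⟨w, rfl⟩
  · rintro h _ ⟨w, rfl⟩
    have := ContinuousLinearMap.adjoint_inner_right ι.toContinuousLinearMap w x
    rw [h, inner_zero_right] at this
    exact this.symm

/-- The vector `x - ι ι* x` lies in `V^⊥`, and `B` keeps it there. Invariance of `V^⊥` and the
compression condition thus merge into the single relation `ι* B = C ι*`, which passes to products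
and limits. -/
lemma adjoint_apply_of_orthogonal_invariant {B : H →L[ℂ] H} {C : V →L[ℂ] V}
    (h1 : ∀ x ∈ (LinearMap.range ι.toLinearMap)ᗮ, B x ∈ (LinearMap.range ι.toLinearMap)ᗮ)
    (h2 : ∀ v, ContinuousLinearMap.adjoint ι.toContinuousLinearMap (B (ι v)) = C v) (x : H) :
    ContinuousLinearMap.adjoint ι.toContinuousLinearMap (B x)
      = C (ContinuousLinearMap.adjoint ι.toContinuousLinearMap x) := by
  set p := ContinuousLinearMap.adjoint ι.toContinuousLinearMap with hp
  have h3 : p (x - ι (p x)) = 0 := by rw [map_sub, hp, adjoint_isometry_apply, sub_self]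
  have h4 := mem_range_orthogonal_iff.mp (h1 _ (mem_range_orthogonal_iff.mpr h3))
  rw [map_sub, map_sub, sub_eq_zero] at h4
  rw [← h2, ← h4]

lemma IsDilation.adjoint_map (h : IsDilation ι σ T ρ S) (ξ : E) (x : H) :
    ContinuousLinearMap.adjoint ι.toContinuousLinearMap (S ξ x)
      = T ξ (ContinuousLinearMap.adjoint ι.toContinuousLinearMap x) :=
  adjoint_apply_of_orthogonal_invariant (h.invariant ξ)
    (fun v => DFunLike.congr_fun (h.compress ξ) v) x

lemma IsDilation.adjoint_left (h : IsDilation ι σ T ρ S) (a : A) (x : H) :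
    ContinuousLinearMap.adjoint ι.toContinuousLinearMap (ρ a x)
      = σ a (ContinuousLinearMap.adjoint ι.toContinuousLinearMap x) :=
  adjoint_apply_of_orthogonal_invariant (h.reduces a)
    (fun v => by rw [h.restrict, adjoint_isometry_apply]) x

lemma IsDilation.of_adjoint_map (hT : IsCovariantRep σ T) (hS : IsCovariantRep ρ S)
    (hρ : ∀ a v, ρ a (ι v) = ι (σ a v))
    (hρ' : ∀ a x, ContinuousLinearMap.adjoint ι.toContinuousLinearMap (ρ a x)
      = σ a (ContinuousLinearMap.adjoint ι.toContinuousLinearMap x))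
    (h : ∀ ξ x, ContinuousLinearMap.adjoint ι.toContinuousLinearMap (S ξ x)
      = T ξ (ContinuousLinearMap.adjoint ι.toContinuousLinearMap x)) : IsDilation ι σ T ρ S where
  isCovariantRep_small := hT
  isCovariantRep_big := hS
  restrict := hρ
  reduces a x hx := by
    rw [mem_range_orthogonal_iff] at hx ⊢
    rw [hρ', hx, map_zero]
  invariant ξ x hx := by
    rw [mem_range_orthogonal_iff] at hx ⊢
    rw [h, hx, map_zero]
  compress ξ := by
    ext v
    have := h ξ (ι v)
    rwa [adjoint_isometry_apply] at this

/-- If `(T, σ)` is fully coisometric, then `V` lies in the closed span of `S(E) V`. -/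
lemma IsDilation.mem_closure_of_isFullyCoisometric (h : IsDilation ι σ T ρ S)
    (hS : IsIsometricRep ρ S) (hT : h.isCovariantRep_small.IsFullyCoisometric) (v : V) :
    ι v ∈ (Submodule.span ℂ {x : H | ∃ (ξ : E) (w : V), x = S ξ (ι w)}).topologicalClosure := by
  set P := Submodule.span ℂ {x : H | ∃ (ξ : E) (w : V), x = S ξ (ι w)} with hP
  set B := h.isCovariantRep_small.tilde with hB
  -- Since `B B* = 1`, the vector `z` is a preimage of `v` of the same norm.
  set z := ContinuousLinearMap.adjoint B v with hz
  have hBz : B z = v := DFunLike.congr_fun hT v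
  have hzz : ‖z‖ ^ 2 = ‖v‖ ^ 2 := by
    have : ⟪z, z⟫_ℂ = ⟪v, v⟫_ℂ := by
      conv_lhs => rw [hz, ContinuousLinearMap.adjoint_inner_left, ← hz, hBz]
    rw [← inner_self_eq_norm_sq (𝕜 := ℂ), this, inner_self_eq_norm_sq]
  -- The map `ξ ⊗ u ↦ S(ξ) ι u` is isometric by isometry of `S`, and `ι*` after it is `B`.
  have hlift (t : E ⊗[ℂ] V) : ∃ x ∈ P, ‖x‖ = ‖tmulₗ σ t‖ ∧
      ContinuousLinearMap.adjoint ι.toContinuousLinearMap x = B (tmulₗ σ t) := by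
    obtain ⟨N, ξ, u, rfl⟩ := TensorProduct.exists_sum_tmul_eq t
    refine ⟨∑ i, S (ξ i) (ι (u i)), P.sum_mem fun i _ => Submodule.subset_span ⟨_, _, rfl⟩, ?_, ?_⟩
    · have h1 : ⟪∑ i, S (ξ i) (ι (u i)), ∑ i, S (ξ i) (ι (u i))⟫_ℂ
          = ⟪tmulₗ σ (∑ i, ξ i ⊗ₜ u i), tmulₗ σ (∑ i, ξ i ⊗ₜ u i)⟫_ℂ := by
        simp only [map_sum, sum_inner, inner_sum]
        refine Finset.sum_congr rfl fun i _ => Finset.sum_congr rfl fun j _ => ?_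
        rw [hS.inner_map, h.restrict, ι.inner_map_map]
        exact (inner_tmul σ _ _ _ _).symm
      rw [norm_eq_sqrt_re_inner (𝕜 := ℂ), norm_eq_sqrt_re_inner (𝕜 := ℂ), h1]
    · simp only [map_sum, h.adjoint_map, adjoint_isometry_apply]
      exact Finset.sum_congr rfl fun i _ => (h.isCovariantRep_small.tilde_tmul _ _).symm
  -- The pair `ι v`, `x` has the same norms and inner product as the pair `z`, `t`, so approximating
  -- `z` by algebraic tensors approximates `ι v` within `P`.
  have hdist (t : E ⊗[ℂ] V) (x : H) (hx : ‖x‖ = ‖tmulₗ σ t‖)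
      (hx' : ContinuousLinearMap.adjoint ι.toContinuousLinearMap x = B (tmulₗ σ t)) :
      ‖ι v - x‖ = ‖z - tmulₗ σ t‖ := by
    have h1 : ⟪ι v, x⟫_ℂ = ⟪z, tmulₗ σ t⟫_ℂ := by
      rw [hz, ContinuousLinearMap.adjoint_inner_left, ← hx',
        ContinuousLinearMap.adjoint_inner_right]
      rfl
    rw [← sq_eq_sq₀ (norm_nonneg _) (norm_nonneg _), norm_sub_sq (𝕜 := ℂ), norm_sub_sq (𝕜 := ℂ),
      h1, hx, ι.norm_map, hzz]
  rw [← SetLike.mem_coe, Submodule.topologicalClosure_coe, Metric.mem_closure_iff]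
  intro ε hε
  obtain ⟨t, ht⟩ := (denseRange_tmulₗ σ (E := E)).exists_dist_lt z hε
  obtain ⟨x, hxP, hx, hx'⟩ := hlift t
  refine ⟨x, hxP, ?_⟩
  rw [dist_eq_norm, hdist t x hx hx', ← dist_eq_norm]
  exact ht

variable {H' : Type*} [NormedAddCommGroup H'] [InnerProductSpace ℂ H'] [CompleteSpace H']
  {ι' : V →ₗᵢ[ℂ] H'} {ρ' : A →⋆ₐ[ℂ] (H' →L[ℂ] H')} {S' : E →ₗ[ℂ] (H' →L[ℂ] H')}

lemma IsDilation.adjoint_prod (h : IsDilation ι σ T ρ S) (l : List E) (x : H) :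
    ContinuousLinearMap.adjoint ι.toContinuousLinearMap ((l.map S).prod x)
      = (l.map T).prod (ContinuousLinearMap.adjoint ι.toContinuousLinearMap x) := by
  induction l with
  | nil => simp
  | cons ξ l ih => simp only [List.map_cons, List.prod_cons, mul_apply_eq_comp, h.adjoint_map, ih]

/-- The coefficient is absorbed by the first letter, or by `v` when the word is empty. Both
dilations are treated at once so that the same new word and vector serve for both. -/
lemma IsDilation.exists_left_prod (h : IsDilation ι σ T ρ S) (h' : IsDilation ι' σ T ρ' S')
    (a : A) (l : List E) (v : V) : ∃ (l' : List E) (v' : V),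
      ρ a ((l.map S).prod (ι v)) = (l'.map S).prod (ι v') ∧
      ρ' a ((l.map S').prod (ι' v)) = (l'.map S').prod (ι' v') := by
  cases l with
  | nil => exact ⟨[], σ a v, by simp [h.restrict], by simp [h'.restrict]⟩
  | cons ξ l =>
    refine ⟨a • ξ :: l, v, ?_, ?_⟩
    · simp [h.isCovariantRep_big.map_smul_left, mul_apply_eq_comp]
    · simp [h'.isCovariantRep_big.map_smul_left, mul_apply_eq_comp]

/-- Isometry cancels the leading letters in pairs, leaving a coefficient from `A` that the remaining
word absorbs. Once one word is empty, `ι*` turns the inner product into one in `V` involving only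
`T`. -/
lemma IsMinimalIsometricDilation.inner_prod_eq (h : IsMinimalIsometricDilation ι σ T ρ S)
    (h' : IsMinimalIsometricDilation ι' σ T ρ' S') (l : List E) :
    ∀ (m : List E) (v w : V), ⟪(l.map S).prod (ι v), (m.map S).prod (ι w)⟫_ℂ
      = ⟪(l.map S').prod (ι' v), (m.map S').prod (ι' w)⟫_ℂ := by
  have key (m : List E) (v w : V) : ⟪ι v, (m.map S).prod (ι w)⟫_ℂ
      = ⟪ι' v, (m.map S').prod (ι' w)⟫_ℂ := by
    have h1 := ContinuousLinearMap.adjoint_inner_right ι.toContinuousLinearMap v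
      ((m.map S).prod (ι w))
    have h2 := ContinuousLinearMap.adjoint_inner_right ι'.toContinuousLinearMap v
      ((m.map S').prod (ι' w))
    rw [h.adjoint_prod, adjoint_isometry_apply] at h1
    rw [h'.adjoint_prod, adjoint_isometry_apply] at h2
    exact h1.symm.trans h2
  induction l with
  | nil => intro m v w; simpa using key m v w
  | cons ξ l ih =>
    intro m v w
    cases m with
    | nil =>
      have := congrArg (starRingEnd ℂ) (key (ξ :: l) w v)
      rw [inner_conj_symm, inner_conj_symm] at this
      simpa using this
    | cons η m =>
      simp only [List.map_cons, List.prod_cons, mul_apply_eq_comp]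
      rw [h.isometric.inner_map, h'.isometric.inner_map]
      obtain ⟨m', w', e, e'⟩ := h.exists_left_prod h'.toIsDilation (ip A ξ η) m w
      rw [e, e', ih]

/-- Minimal isometric dilations are unique up to a unitary equivalence that fixes `V`. -/
theorem IsMinimalIsometricDilation.exists_unitary (h : IsMinimalIsometricDilation ι σ T ρ S)
    (h' : IsMinimalIsometricDilation ι' σ T ρ' S') :
    ∃ U : H ≃ₗᵢ[ℂ] H', (∀ v, U (ι v) = ι' v) ∧ (∀ a x, U (ρ a x) = ρ' a (U x)) ∧
      ∀ ξ x, U (S ξ x) = S' ξ (U x) := by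
  have hr : {x : H | ∃ (l : List E) (v : V), x = (l.map S).prod (ι v)}
      = Set.range fun p : List E × V => (p.1.map S).prod (ι p.2) := by
    ext x; simp [eq_comm]
  have hr' : {x : H' | ∃ (l : List E) (v : V), x = (l.map S').prod (ι' v)}
      = Set.range fun p : List E × V => (p.1.map S').prod (ι' p.2) := by
    ext x; simp [eq_comm]
  have hd := h.minimal
  have hd' := h'.minimal
  rw [hr] at hd
  rw [hr'] at hd'
  obtain ⟨U, hU⟩ := exists_unitary_of_gram_eq
    (fun p q => h.inner_prod_eq h' p.1 q.1 p.2 q.2) hd hd'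
  have hU' (l : List E) (v : V) : U ((l.map S).prod (ι v)) = (l.map S').prod (ι' v) := hU (l, v)
  -- An intertwining relation for `U` need only be checked on the spanning vectors.
  have hext (B : H →L[ℂ] H) (B' : H' →L[ℂ] H')
      (hB : ∀ (l : List E) (v : V), U (B ((l.map S).prod (ι v))) = B' ((l.map S').prod (ι' v)))
      (x : H) : U (B x) = B' (U x) := by
    have : U.toContinuousLinearEquiv.toContinuousLinearMap ∘L B
        = B' ∘L U.toContinuousLinearEquiv.toContinuousLinearMap := by
      refine ContinuousLinearMap.ext_on (Submodule.dense_iff_topologicalClosure_eq_top.mpr hd) ?_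
      rintro _ ⟨⟨l, v⟩, rfl⟩
      exact (hB l v).trans (by rw [← hU']; rfl)
    exact DFunLike.congr_fun this x
  refine ⟨U, fun v => by simpa using hU' [] v, fun a => hext _ _ fun l v => ?_,
    fun ξ => hext _ _ fun l v => ?_⟩
  · obtain ⟨l', v', e, e'⟩ := h.exists_left_prod h'.toIsDilation a l v
    rw [e, e', hU']
  · simpa [mul_apply_eq_comp] using hU' (ξ :: l) v

end Dilation

/-! ### Components of a dilation and minimality -/

namespace Rep
variable {k : ℕ} {A : Type*} [CStarAlgebra A] [PartialOrder A] [StarOrderedRing A]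
  {E : (Fin k → ℕ) → Type*} [∀ n, NormedAddCommGroup (E n)] [∀ n, NormedSpace ℂ (E n)]
  [∀ n, Module A (E n)] [∀ n, Module Aᵐᵒᵖ (E n)] [∀ n, CStarCorrespondence A (E n)]
  [GradedMonoid.GMonoid E] [ProductSystem A E]
  {V : Type*} [NormedAddCommGroup V] [InnerProductSpace ℂ V] [CompleteSpace V]
  {H : Type*} [NormedAddCommGroup H] [InnerProductSpace ℂ H] [CompleteSpace H]
  {R : Rep A E V} {S : Rep A E H} {ι : V →ₗᵢ[ℂ] H}

/-- Induction on a multidegree, one generator at a time. -/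
lemma degree_induction {p : (Fin k → ℕ) → Prop} (zero : p 0)
    (add_single : ∀ n i, p n → p (n + Pi.single i 1)) (n : Fin k → ℕ) : p n := by
  rw [← wordDegree_canonicalWord n]
  generalize canonicalWord n = L
  induction L using List.reverseRecOn with
  | nil => exact zero
  | append_singleton L i ih =>
    have : wordDegree (L ++ [i]) = wordDegree L + Pi.single i 1 := by simp [wordDegree]
    rw [this]
    exact add_single _ _ ih

/-- In degree zero the component is the left action, whose compatibility with `ι*` is part of the
dilation data of any one generator; hence `0 < k`. -/
lemma adjoint_component (hk : 0 < k)
    (h : ∀ i, IsDilation ι R.σ (R.toFun i) S.σ (S.toFun i)) (n : Fin k → ℕ) :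
    ∀ (ξ : E n) (x : H), ContinuousLinearMap.adjoint ι.toContinuousLinearMap (S.component n ξ x)
      = R.component n ξ (ContinuousLinearMap.adjoint ι.toContinuousLinearMap x) := by
  induction n using degree_induction with
  | zero =>
    intro ξ x
    obtain ⟨a, rfl⟩ := ProductSystem.exists_smul_one (A := A) ξ
    rw [component_zero, component_zero, (h ⟨0, hk⟩).adjoint_left]
  | add_single n i ih =>
    intro ξ x
    refine DFunLike.congr_fun (ext_gmul (A := A) inferInstance
      (f := ContinuousLinearMap.adjoint ι.toContinuousLinearMap ∘L S.componentEval _ x)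
      (g := R.componentEval _ (ContinuousLinearMap.adjoint ι.toContinuousLinearMap x))
      fun y z => ?_) ξ
    simp only [ContinuousLinearMap.comp_apply, componentEval_apply, component_mul,
      component_single, mul_apply_eq_comp, ih, (h i).adjoint_map]

lemma isDilation_component (hk : 0 < k)
    (h : ∀ i, IsDilation ι R.σ (R.toFun i) S.σ (S.toFun i)) (n : Fin k → ℕ) :
    IsDilation ι R.σ (R.component n) S.σ (S.component n) :=
  .of_adjoint_map (R.isCovariantRep_component n) (S.isCovariantRep_component n)
    (h ⟨0, hk⟩).restrict (h ⟨0, hk⟩).adjoint_left (adjoint_component hk h n)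

variable (S ι) in
/-- The closed linear span of `S_n(E n) V`. -/
noncomputable def componentSpan (n : Fin k → ℕ) : Submodule ℂ H :=
  (Submodule.span ℂ {x : H | ∃ (ξ : E n) (v : V), x = S.component n ξ (ι v)}).topologicalClosure

lemma componentSpan_le {n : Fin k → ℕ} {P : Submodule ℂ H} (hP : IsClosed (P : Set H))
    (h : ∀ ξ v, S.component n ξ (ι v) ∈ P) : S.componentSpan ι n ≤ P := by
  refine Submodule.topologicalClosure_minimal _ (Submodule.span_le.mpr ?_) hP
  rintro _ ⟨ξ, v, rfl⟩
  exact h ξ v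

lemma component_mem_componentSpan {n : Fin k → ℕ} (ξ : E n) (v : V) :
    S.component n ξ (ι v) ∈ S.componentSpan ι n :=
  Submodule.le_topologicalClosure _ (Submodule.subset_span ⟨ξ, v, rfl⟩)

lemma isClosed_componentSpan {n : Fin k → ℕ} : IsClosed (S.componentSpan ι n : Set H) :=
  Submodule.isClosed_topologicalClosure _

/-- Full coisometry places `V` in `[S_i(E_i)V]`; the bounded operator `S_n(ξ)` maps this space into
`[S_{n+e_i}(E(n+e_i))V]`. -/
lemma componentSpan_le_add_single (h : ∀ i, IsDilation ι R.σ (R.toFun i) S.σ (S.toFun i))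
    (hS : S.IsIsometric) (hR : R.IsFullyCoisometric) (n : Fin k → ℕ) (i : Fin k) :
    S.componentSpan ι n ≤ S.componentSpan ι (n + Pi.single i 1) := by
  refine componentSpan_le isClosed_componentSpan fun ξ v => ?_
  have hv := (h i).mem_closure_of_isFullyCoisometric (hS i) (hR i) v
  have hle : (Submodule.span ℂ {x : H | ∃ (η : E (Pi.single i 1)) (w : V),
      x = S.toFun i η (ι w)}).topologicalClosure
      ≤ (S.componentSpan ι (n + Pi.single i 1)).comap (S.component n ξ).toLinearMap := by
    refine Submodule.topologicalClosure_minimal _ (Submodule.span_le.mpr ?_)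
      (isClosed_componentSpan.preimage (S.component n ξ).continuous)
    rintro _ ⟨η, w, rfl⟩
    have := component_mem_componentSpan (S := S) (ι := ι)
      (GradedMonoid.GMul.mul ξ η : E (n + Pi.single i 1)) w
    rwa [component_mul, component_single] at this
  exact hle hv

lemma componentSpan_le_add (h : ∀ i, IsDilation ι R.σ (R.toFun i) S.σ (S.toFun i))
    (hS : S.IsIsometric) (hR : R.IsFullyCoisometric) (n m : Fin k → ℕ) :
    S.componentSpan ι n ≤ S.componentSpan ι (n + m) := by
  induction m using degree_induction with
  | zero => rw [add_zero]
  | add_single m i ih =>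
    rw [← add_assoc]
    exact ih.trans (componentSpan_le_add_single h hS hR _ i)

lemma componentSpan_nsmul_le (n : Fin k → ℕ) {P : Submodule ℂ H} (hP : IsClosed (P : Set H))
    (hA : ∀ a v, S.σ a (ι v) ∈ P) (hn : ∀ ξ, ∀ x ∈ P, S.component n ξ x ∈ P) (N : ℕ) :
    S.componentSpan ι (N • n) ≤ P := by
  induction N with
  | zero =>
    rw [zero_nsmul]
    refine componentSpan_le hP fun ξ v => ?_
    obtain ⟨a, rfl⟩ := ProductSystem.exists_smul_one (A := A) ξ
    rw [component_zero]
    exact hA a v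
  | succ N ih =>
    -- The new factor `n` goes on the left, so that `S_n` is applied last and invariance of `P` can
    -- be used.
    rw [succ_nsmul']
    refine componentSpan_le hP fun ξ v => ?_
    have hle : (⊤ : Submodule ℂ (E (n + N • n)))
        ≤ P.comap (S.componentEval (n + N • n) (ι v)).toLinearMap := by
      rw [← Submodule.dense_iff_topologicalClosure_eq_top.mp
        (ProductSystem.dense_mul (A := A) n (N • n))]
      refine Submodule.topologicalClosure_minimal _ (Submodule.span_le.mpr ?_)
        (hP.preimage (S.componentEval (n + N • n) (ι v)).continuous)
      rintro _ ⟨⟨x, y⟩, rfl⟩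
      change S.component _ (GradedMonoid.GMul.mul x y) (ι v) ∈ P
      rw [component_mul]
      exact hn _ _ (ih (component_mem_componentSpan y v))
    exact hle (Submodule.mem_top (x := ξ))

theorem IsMinimalIsometricDilation.component (hk : 0 < k) (hR : R.IsFullyCoisometric)
    (hS : IsMinimalIsometricDilation ι R S) (n : Fin k → ℕ) (hn : ∀ i, n i ≠ 0) :
    CStarCorrespondence.IsMinimalIsometricDilation ι R.σ (R.component n) S.σ (S.component n) where
  toIsDilation := isDilation_component hk hS.dilation n
  isometric := IsIsometric.component hS.isometric n
  minimal := by
    set P := (Submodule.span ℂ {x : H | ∃ (l : List (E n)) (v : V),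
      x = (l.map (S.component n)).prod (ι v)}).topologicalClosure with hPdef
    have hP : IsClosed (P : Set H) := Submodule.isClosed_topologicalClosure _
    have hA (a : A) (v : V) : S.σ a (ι v) ∈ P :=
      Submodule.le_topologicalClosure _ (Submodule.subset_span
        ⟨[], R.σ a v, by simp [(hS.dilation ⟨0, hk⟩).restrict]⟩)
    have hinv (ξ : E n) (x : H) (hx : x ∈ P) : S.component n ξ x ∈ P := by
      have hle : P ≤ P.comap (S.component n ξ).toLinearMap := by
        refine Submodule.topologicalClosure_minimal _ (Submodule.span_le.mpr ?_)
          (hP.preimage (S.component n ξ).continuous)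
        rintro _ ⟨l, v, rfl⟩
        exact Submodule.le_topologicalClosure _ (Submodule.subset_span
          ⟨ξ :: l, v, by simp [mul_apply_eq_comp]⟩)
      exact hle hx
    rw [eq_top_iff, ← hS.minimal]
    refine Submodule.topologicalClosure_minimal _ (Submodule.span_le.mpr ?_) hP
    rintro _ ⟨m, ξ, v, rfl⟩
    -- With `N = ∑ m_i`, each `m_j ≤ N ≤ N n_j` because `n_j ≥ 1`. So `N n - m` is a genuine
    -- multidegree and the span in degree `m` lies in the one in degree `N n`.
    have hm : m ≤ (∑ i, m i) • n := fun i => by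
      rw [Pi.smul_apply, smul_eq_mul]
      exact (Finset.single_le_sum (fun _ _ => Nat.zero_le _) (Finset.mem_univ i)).trans
        (Nat.le_mul_of_pos_right _ (Nat.pos_of_ne_zero (hn i)))
    have h1 := componentSpan_le_add hS.dilation hS.isometric hR m ((∑ i, m i) • n - m)
    rw [add_tsub_cancel_of_le hm] at h1
    exact componentSpan_nsmul_le n hP hA hinv _ (h1 (component_mem_componentSpan ξ v))

end Rep
end CStarCorrespondence

theorem mainTheorem7 {k : ℕ} (hk : 0 < k)
    {A : Type*} [CStarAlgebra A] [PartialOrder A] [StarOrderedRing A]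
    (E : (Fin k → ℕ) → Type*) [∀ n, NormedAddCommGroup (E n)] [∀ n, NormedSpace ℂ (E n)]
    [∀ n, Module A (E n)] [∀ n, Module Aᵐᵒᵖ (E n)]
    [∀ n, CStarCorrespondence A (E n)] [GradedMonoid.GMonoid E]
    [CStarCorrespondence.ProductSystem A E]
    {V : Type*} [NormedAddCommGroup V] [InnerProductSpace ℂ V] [CompleteSpace V]
    {H : Type*} [NormedAddCommGroup H] [InnerProductSpace ℂ H] [CompleteSpace H]
    (R : CStarCorrespondence.Rep A E V) (hR : R.IsFullyCoisometric)
    (S : CStarCorrespondence.Rep A E H) (ι : V →ₗᵢ[ℂ] H)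
    (hS : CStarCorrespondence.Rep.IsMinimalIsometricDilation ι R S)
    (n : Fin k → ℕ) (hn : ∀ i, n i ≠ 0) :
    CStarCorrespondence.IsMinimalIsometricDilation ι R.σ (R.component n) S.σ (S.component n) ∧
    ∀ (H' : Type*) [NormedAddCommGroup H'] [InnerProductSpace ℂ H'] [CompleteSpace H']
      (ι' : V →ₗᵢ[ℂ] H') (ρ' : A →⋆ₐ[ℂ] (H' →L[ℂ] H')) (S' : E n →ₗ[ℂ] (H' →L[ℂ] H')),
      CStarCorrespondence.IsMinimalIsometricDilation ι' R.σ (R.component n) ρ' S' →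
      ∃ U : H ≃ₗᵢ[ℂ] H', (∀ v, U (ι v) = ι' v) ∧ (∀ a x, U (S.σ a x) = ρ' a (U x)) ∧
        ∀ ξ x, U (S.component n ξ x) = S' ξ (U x) :=
  ⟨hS.component hk hR n hn, fun _ _ _ _ _ _ _ h' => (hS.component hk hR n hn).exists_unitary h'⟩
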